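/- **Online lead-time quotation (OLTQ).** Fix an integer $\ell\ge 1$. Periods are $t=1,2,3,\dots$; in period $t$, $e_t\in\{0,1,\dots,\ell\}$ requests arrive and an action $a_t=(a_t(1),\dots,a_t(\ell))\in\{t,\dots,t+\ell-1,\infty\}^\ell$ is chosen, where $a_t(i)$ is the processing time quoted to the $i$-th request of period $t$ (only $i\le e_t$ matters). The reward of period $t$ is $$R_t(e_{1:t},a_{1:t})=\sum_{s=1}^{t}\sum_{i=1}^{e_s}[s+\ell-a_s(i)]_+\,\mathbb I(a_s(i)=t)\prod_{j<s}\prod_{k=1}^{e_j}\mathbb I(a_j(k)\ne t)\prod_{k=1}^{i-1}\mathbb I(a_s(k)\neq t).$$ Let $\mathrm{Val}(e,a)=\sum_{t\ge1}R_t(e_{1:t},a_{1:t})$ and $\mathrm{Opt}(e)=\max_a \mathrm{Val}(e,a)$. For a history $(e_{1:\tau-1},a_{1:\tau-1})$ let $\mathrm{Opt}(e_{\tau:t}\mid a_{1:\tau-1})$ be the maximum of $\sum_{r=\tau}^{t}R_r$ over all continuations $a_{\tau},a_{\tau+1},\dots$ of the actions. The competitive ratio on $e$ of a deterministic online algorithm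 with actions $a$ is $\mathrm{Comp}=\mathrm{Val}(e,a)/\mathrm{Opt}(e)$. Put $$\gamma^*=\sqrt{\tfrac54+\tfrac1\ell}-\tfrac12,\qquad \eta=\eta^{\mathrm{OLTQ}}=\min\left\{\frac{\lfloor\gamma^*\ell\rfloor}{\ell},\ \frac{(\ell+\lceil\gamma^*\ell\rceil)(\ell-\lceil\gamma^*\ell\rceil+1)}{\ell(\ell+1)}\right\}.$$ **AdaSwitch-OLTQ** receives a predicted sequence $e^*=(e^*_t)_{t\ge1}$ and a slackness parameter $\epsilon>0$, and uses $c=\ell+1$. It is in a conservative or a predictive state, initially conservative with $\tau=1$, $U=1$. In period $t$ it observes $e_t$. * *Conservative state (Q-FRAC$^*$ started at $\tau$).* Let $N=\min(e_t,\lfloor t+\ell-U+1-\eta\ell\rfloor)$, play $a_t(i)=U+i-1$ for $i\le N$ and $a_t(i)=\infty$ otherwise, and replace $U$ by $\max(t+1,U+N)$. If $\mathrm{Opt}(e_{\tau:t}\mid a_{1:\tau-1})\ge 10c\ell/\epsilon$, switch to the predictive state with $\varphi=0$. * *Predictive state.* Run O-HRR$^*$ on the requests $e_t,e^*_{t+1},e^*_{t+2},\dots$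 given the history up to period $t-1$, and play the action it plans for period $t$: initially all requests of periods $\ge t$ are unscheduled (quote $\infty$); for $r=t,t+1,\dots,\max\{t,\max\{s:e^*_s>0\}\}+\ell-1$ in order (the inner maximum being $0$ if $e^*\equiv0$), if $r$ was not quoted to any request of periods before $t$ and some unscheduled request arrives in a period of $[\max(t,r-\ell+1),r]$, give slot $r$ to an unscheduled request of the latest such period. Then increase $\varphi$ by $\min(|e_t-e^*_t|,c)$; if $\varphi\ge 2c/\eta$, switch to the conservative state with $\tau=U=t+1$. **Theorem.** Let $e,e^*$ be sequences in $\{0,\dots,\ell\}$ with $\sum_{t\ge1} e_t<\infty$, $\sum_{t\ge1} e^*_t<\infty$ and $e\not\equiv0$, and let $\varphi^*=\sum_{t\ge1}|e_t-e^*_t|$. For every $\epsilon\in(0,\eta^{\mathrm{OLTQ}})$ and every rule by which O-HRR$^*$ chooses among the unscheduled requests of one period, $$\mathrm{Comp}(e,e^*,\text{AdaSwitch-OLTQ})\ \ge\ \max\left\{\eta^{\mathrm{OLTQ}}-\epsilon,\ 1-\frac{\ell}{\epsilon\cdot\mathrm{Opt}(e)}\bigl(24\ell+8\eta^{\mathrm{OLTQ}}\varphi^*\bigr)\right\}.$$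 -/

import Mathlib

/-! Online lead-time quotation with predictions, and the algorithm AdaSwitch-OLTQ.

Periods are `t = 1, 2, 3, …` and the requests arriving in period `t` are numbered
`1, …, e t`; the values of all sequences at index `0` are irrelevant. -/

noncomputable section

namespace OLTQ

/-- An action: the processing time quoted to each request of one period (`⊤` is the quote `∞`). -/
abbrev Action := ℕ → ℕ∞

/-- `x` belongs to the action set `A_t = {t, …, t + ℓ - 1, ∞}^ℓ`. -/
def IsAction (ℓ t : ℕ) (x : Action) : Prop :=
  ∀ i ∈ Finset.Icc 1 ℓ, x i = ⊤ ∨ ∃ d < ℓ, x i = ((t + d : ℕ) : ℕ∞)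

/-- The reward `R_t(e_{1:t}, a_{1:t})` collected in period `t`: request `i` of period `s`, quoted
the processing time `t`, pays `[s + ℓ - t]_+` (truncated subtraction), provided that no request of
an earlier period and no request of the same period with a smaller index was quoted `t`. -/
def reward (ℓ : ℕ) (e : ℕ → ℕ) (a : ℕ → Action) (t : ℕ) : ℝ :=
  ∑ s ∈ Finset.Icc 1 t, ∑ i ∈ Finset.Icc 1 (e s),
    if a s i = (t : ℕ∞)
        ∧ (∀ j ∈ Finset.Ico 1 s, ∀ k ∈ Finset.Icc 1 (e j), a j k ≠ (t : ℕ∞))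
        ∧ (∀ k ∈ Finset.Ico 1 i, a s k ≠ (t : ℕ∞))
    then ((s + ℓ - t : ℕ) : ℝ) else 0

/-- `Val(OLTQ, e, a)`, the total reward of the action sequence `a` (for a finite request sequence
only finitely many terms are nonzero). -/
def val (ℓ : ℕ) (e : ℕ → ℕ) (a : ℕ → Action) : ℝ :=
  ∑' t : ℕ, reward ℓ e a (t + 1)

/-- `Opt(OLTQ, e)`, the optimal total reward in hindsight. -/
def opt (ℓ : ℕ) (e : ℕ → ℕ) : ℝ :=
  sSup {v | ∃ a : ℕ → Action, (∀ t, 1 ≤ t → IsAction ℓ t (a t)) ∧ v = val ℓ e a}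

/-- `Opt(OLTQ^I, e_{τ:t})` with the history `I = (e_{1:τ-1}, a_{1:τ-1})`: the largest reward that
can be collected during the periods `τ, …, t` when the actions before `τ` are those of `a`. -/
def partialOpt (ℓ : ℕ) (e : ℕ → ℕ) (a : ℕ → Action) (τ t : ℕ) : ℝ :=
  sSup {v | ∃ a' : ℕ → Action, (∀ j < τ, a' j = a j) ∧ (∀ j, τ ≤ j → IsAction ℓ j (a' j)) ∧
    v = ∑ r ∈ Finset.Icc τ t, reward ℓ e a' r}

/-- A deterministic online algorithm: in each period it sees the current number of requests,
chooses an action and updates its internal state. -/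
structure OnlineAlgorithm where
  State : Type
  init : State
  step : State → ℕ → State × Action

/-- The internal state after the periods `1, …, t`. -/
def OnlineAlgorithm.state (A : OnlineAlgorithm) (e : ℕ → ℕ) : ℕ → A.State
  | 0 => A.init
  | t + 1 => (A.step (A.state e t) (e (t + 1))).1

/-- The action `a_t` that the algorithm chooses in period `t ≥ 1`. -/
def OnlineAlgorithm.action (A : OnlineAlgorithm) (e : ℕ → ℕ) : ℕ → Action
  | 0 => fun _ => ⊤
  | t + 1 => (A.step (A.state e t) (e (t + 1))).2

/-- The competitive ratio on the request sequence `e`. -/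
def comp (ℓ : ℕ) (e : ℕ → ℕ) (A : OnlineAlgorithm) : ℝ :=
  val ℓ e (A.action e) / opt ℓ e

/-! ### The offline oracle O-HRR* -/

/-- Period `r` is reserved by a request that arrived in one of the periods `1, …, m`. -/
def Reserved (e : ℕ → ℕ) (a : ℕ → Action) (m r : ℕ) : Prop :=
  ∃ j ∈ Finset.Icc 1 m, ∃ k ∈ Finset.Icc 1 (e j), a j k = (r : ℕ∞)

instance (e : ℕ → ℕ) (a : ℕ → Action) (m r : ℕ) : Decidable (Reserved e a m r) := by
  unfold Reserved; infer_instance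

/-- The requests of period `i` that are not scheduled by `a`. -/
def unscheduled (e : ℕ → ℕ) (a : ℕ → Action) (i : ℕ) : Finset ℕ :=
  (Finset.Icc 1 (e i)).filter fun j => a i j = ⊤

/-- The set `U_r` of the periods `i` with `max (m + 1) (r - ℓ + 1) ≤ i ≤ r` that have an
unscheduled request. -/
def candidates (ℓ : ℕ) (e : ℕ → ℕ) (a : ℕ → Action) (m r : ℕ) : Finset ℕ :=
  (Finset.Icc (max (m + 1) (r + 1 - ℓ)) r).filter fun i => (unscheduled e a i).Nonempty

/-- Slot `r` of O-HRR*: if it is free and `U_r` is nonempty, it is given to an unscheduled request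
of the most recent period in `U_r`; `sel r` is the rule that picks one of these requests. -/
def ohrrSlot (ℓ : ℕ) (sel : ℕ → Finset ℕ → ℕ) (e : ℕ → ℕ) (m : ℕ) (a : ℕ → Action) (r : ℕ) :
    ℕ → Action :=
  if Reserved e a m r then a
  else if h : (candidates ℓ e a m r).Nonempty then
    let i := (candidates ℓ e a m r).max' h
    Function.update a i (Function.update (a i) (sel r (unscheduled e a i)) (r : ℕ∞))
  else a

/-- O-HRR* with history `(e_{1:m}, a_{1:m})`, after the slots `m + 1, …, m + k`. -/
def ohrr (ℓ : ℕ) (sel : ℕ → Finset ℕ → ℕ) (e : ℕ → ℕ) (a : ℕ → Action) (m : ℕ) :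
    ℕ → ℕ → Action
  | 0 => fun j => if j ≤ m then a j else fun _ => ⊤
  | k + 1 => ohrrSlot ℓ sel e m (ohrr ℓ sel e a m k) (m + k + 1)

/-! ### The online oracle Q-FRAC* -/

/-- `γ* = √(5/4 + 1/ℓ) - 1/2`. -/
def gammaStar (ℓ : ℕ) : ℝ := √(5 / 4 + 1 / (ℓ : ℝ)) - 1 / 2

/-- `η^OLTQ`. -/
def eta (ℓ : ℕ) : ℝ :=
  min ((⌊gammaStar ℓ * ℓ⌋ : ℝ) / ℓ)
    (((ℓ : ℝ) + ⌈gammaStar ℓ * ℓ⌉) * ((ℓ : ℝ) - ⌈gammaStar ℓ * ℓ⌉ + 1) / ((ℓ : ℝ) * (ℓ + 1)))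

/-- The number `N_t` of requests that Q-FRAC* schedules in period `t` when `x` requests arrive and
its first unassigned slot is `U`. -/
def qfracCount (ℓ t U x : ℕ) : ℕ :=
  min x ⌊(t : ℝ) + ℓ - U + 1 - eta ℓ * ℓ⌋₊

/-- The action of Q-FRAC*: the first `N` requests get the slots `U, …, U + N - 1`. -/
def qfracAction (U N : ℕ) : Action :=
  fun i => if i ≤ N then ((U + i - 1 : ℕ) : ℕ∞) else ⊤

/-! ### AdaSwitch-OLTQ -/

inductive Mode
  | conservative
  | predictive

/-- What AdaSwitch-OLTQ remembers: the number of elapsed periods, the observed requests, the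
executed actions, its mode, the initial period `τ` of the current conservative phase, the first
unassigned slot `U` of the current run of Q-FRAC*, and the prediction error `φ` of the current
predictive phase. -/
structure AdaState where
  time : ℕ
  reqs : ℕ → ℕ
  acts : ℕ → Action
  mode : Mode
  τ : ℕ
  U : ℕ
  φ : ℝ

/-- The effective length estimator `max {t, max {s : e*_s > 0}} + ℓ - 1`. -/
def estimateM (ℓ t : ℕ) (estar : ℕ → ℕ) : ℕ :=
  max t (sSup {s | 1 ≤ s ∧ 0 < estar s}) + ℓ - 1

/-- One period of AdaSwitch with `L = ℓ`, `b = 1`, `c = ℓ + 1`, offline oracle O-HRR* and online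
oracle Q-FRAC*; `x` is the number of arriving requests. -/
def adaStep (ℓ : ℕ) (ε : ℝ) (sel : ℕ → ℕ → Finset ℕ → ℕ) (estar : ℕ → ℕ) (σ : AdaState) (x : ℕ) :
    AdaState × Action :=
  let L : ℝ := ℓ
  let b : ℝ := 1
  let c : ℝ := ℓ + 1
  let t := σ.time + 1
  let reqs := Function.update σ.reqs t x
  match σ.mode with
  | Mode.conservative =>
    let N := qfracCount ℓ t σ.U x
    let at' := qfracAction σ.U N
    let acts := Function.update σ.acts t at'
    let U := max (t + 1) (σ.U + N)
    let s := partialOpt ℓ reqs acts σ.τ t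
    open Classical in
    if 10 * c * L / ε ≤ s then (⟨t, reqs, acts, Mode.predictive, σ.τ, U, 0⟩, at')
    else (⟨t, reqs, acts, Mode.conservative, σ.τ, U, σ.φ⟩, at')
  | Mode.predictive =>
    let e' : ℕ → ℕ := fun s => if s ≤ t then reqs s else estar s
    let plan := ohrr ℓ (sel t) e' σ.acts σ.time (estimateM ℓ t estar - σ.time)
    let at' := plan t
    let acts := Function.update σ.acts t at'
    let φ := σ.φ + min |(x : ℝ) - estar t| (c / b)
    open Classical in
    if 2 * c / (eta ℓ * b) ≤ φ then
      (⟨t, reqs, acts, Mode.conservative, t + 1, t + 1, φ⟩, at')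
    else (⟨t, reqs, acts, Mode.predictive, σ.τ, σ.U, φ⟩, at')

/-- AdaSwitch-OLTQ with prediction `estar` and slackness parameter `ε`. The rule `sel t r` is the
one by which the run of O-HRR* in period `t` picks a request for slot `r`. -/
def adaSwitch (ℓ : ℕ) (ε : ℝ) (sel : ℕ → ℕ → Finset ℕ → ℕ) (estar : ℕ → ℕ) : OnlineAlgorithm where
  State := AdaState
  init := ⟨0, fun _ => 0, fun _ _ => ⊤, Mode.conservative, 1, 1, 0⟩
  step := adaStep ℓ ε sel estar

end OLTQ

end

/-! An action sequence matters only through the matching it induces between slots and arrival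
periods (`own`), and its value is the total weight of that matching. The matching of the algorithm
is compared with the matching `x` of an arbitrary competitor. Rewards are charged to the period in
which the request arrived (`seg`), so both values split additively over the phases of the algorithm,
which are intervals of periods.

Conservative phase. Q-FRAC* accepts a request only if it pays at least k = ⌈ηℓ⌉. Without a
rejection, each new request pays at least ηℓ against at most ℓ for the competitor. At a rejection,
all slots from the last period without backlog up to the acceptance limit are filled, and two
arithmetic sums again give the ratio η (`Run.step`). Slots reserved by earlier phases spoil at most
ℓ each (`Conservative.le`).

Predictive phase. O-HRR* completes a given history optimally, by exchanging requests between slots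
(`exists_exchange`). Hence the reward collected so far in the phase plus the best value still
available from the predicted requests drops by at most ℓ per overpredicted request
(`predictive_step`). Telescoping, and paying ℓ for each underpredicted request, bounds the loss of
the phase by ℓ times its prediction error plus 2ℓ(ℓ-1) for the slots shared with the neighbouring
phases (`predictive_phase`).

Accounting. For robustness, a conservative phase earns the fraction η while only η - ε is claimed;
as it ends only when its optimum reaches 10(ℓ+1)ℓ/ε, it saves roughly 10(ℓ+1)ℓ, which pays for the
next predictive phase and for the backlog that phase leaves behind. For consistency, a conservative
phase loses at most about its switching threshold, and each completed pair of phases consumes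
prediction error at least 2(ℓ+1)/η, so the number K of pairs is at most η·err/(2(ℓ+1)). `Invariant`
carries both accounts through time. -/

namespace OLTQ

/-! ### Matchings of slots to periods -/

/-- The reward of serving a request of period `s` in slot `r`; period `0` means that the slot is
unused. -/
def wt (ℓ s r : ℕ) : ℕ := if s = 0 then 0 else s + ℓ - r

/-- The number of slots below `M` that `x` gives to requests of period `s`. -/
def cnt (M : ℕ) (x : ℕ → ℕ) (s : ℕ) : ℕ := ∑ r ∈ Finset.range M, if x r = s then 1 else 0

/-- The total reward of the slots below `M`. -/
def mval (ℓ M : ℕ) (x : ℕ → ℕ) : ℕ := ∑ r ∈ Finset.range M, wt ℓ (x r) r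

/-- The reward of the slots below `M` that serve requests of the periods `p, …, q`. -/
def seg (ℓ M : ℕ) (x : ℕ → ℕ) (p q : ℕ) : ℕ :=
  ∑ r ∈ Finset.range M, if p ≤ x r ∧ x r ≤ q then wt ℓ (x r) r else 0

/-- `x` gives slots outside `B` to requests that have already arrived, at most `n s` of them
to requests of period `s`. -/
structure Feas (M : ℕ) (B : ℕ → Prop) (n : ℕ → ℕ) (x : ℕ → ℕ) : Prop where
  free : ∀ r, x r ≠ 0 → ¬ B r
  le : ∀ r, x r ≤ r
  cap : ∀ s, 1 ≤ s → cnt M x s ≤ n s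

theorem sum_update_add (F : ℕ → ℕ → ℕ) (x : ℕ → ℕ) {M a : ℕ} (ha : a < M) (v : ℕ) :
    (∑ r ∈ Finset.range M, F (Function.update x a v r) r) + F (x a) a
      = (∑ r ∈ Finset.range M, F (x r) r) + F v a := by
  have h := Finset.mem_range.2 ha
  rw [← Finset.add_sum_erase _ _ h, ← Finset.add_sum_erase _ (fun r => F (x r) r) h]
  have : ∑ r ∈ (Finset.range M).erase a, F (Function.update x a v r) r
      = ∑ r ∈ (Finset.range M).erase a, F (x r) r :=
    Finset.sum_congr rfl fun r hr => by rw [Function.update_of_ne (Finset.ne_of_mem_erase hr)]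
  simp only [Function.update_self, this]
  omega

theorem cnt_update (x : ℕ → ℕ) {M a : ℕ} (ha : a < M) (v s : ℕ) :
    cnt M (Function.update x a v) s + (if x a = s then 1 else 0)
      = cnt M x s + (if v = s then 1 else 0) :=
  sum_update_add (fun v _ => if v = s then 1 else 0) x ha v

theorem mval_update (ℓ : ℕ) (x : ℕ → ℕ) {M a : ℕ} (ha : a < M) (v : ℕ) :
    mval ℓ M (Function.update x a v) + wt ℓ (x a) a = mval ℓ M x + wt ℓ v a :=
  sum_update_add (wt ℓ) x ha v

theorem cnt_eq_card (M : ℕ) (x : ℕ → ℕ) (s : ℕ) :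
    cnt M x s = ((Finset.range M).filter fun r => x r = s).card := by
  rw [cnt, Finset.card_filter]

theorem cnt_pos {M : ℕ} {x : ℕ → ℕ} {r : ℕ} (hr : r < M) : 1 ≤ cnt M x (x r) := by
  rw [cnt_eq_card]
  exact Finset.card_pos.2 ⟨r, by simp [hr]⟩

theorem cnt_mono {M : ℕ} {x y : ℕ → ℕ} {s : ℕ} (h : ∀ r, x r = s → y r = s) :
    cnt M x s ≤ cnt M y s := by
  simp only [cnt_eq_card]
  exact Finset.card_le_card fun r => by
    simp only [Finset.mem_filter]
    exact fun hr => ⟨hr.1, h r hr.2⟩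

theorem wt_le {ℓ s r : ℕ} (h : s ≤ r) : wt ℓ s r ≤ ℓ := by
  unfold wt; split_ifs <;> omega

theorem wt_of_ne {ℓ s r : ℕ} (h : s ≠ 0) : wt ℓ s r = s + ℓ - r := if_neg h

theorem wt_zero {ℓ r : ℕ} : wt ℓ 0 r = 0 := if_pos rfl

theorem seg_add {ℓ M : ℕ} (x : ℕ → ℕ) {p q q' : ℕ} (hpq : p ≤ q + 1) (hq : q ≤ q') :
    seg ℓ M x p q' = seg ℓ M x p q + seg ℓ M x (q + 1) q' := by
  unfold seg
  rw [← Finset.sum_add_distrib]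
  refine Finset.sum_congr rfl fun r _ => ?_
  split_ifs <;> omega

theorem seg_empty {ℓ M : ℕ} (x : ℕ → ℕ) {p q : ℕ} (h : q < p) : seg ℓ M x p q = 0 :=
  Finset.sum_eq_zero fun r _ => if_neg (by omega)

theorem seg_self_le {ℓ M : ℕ} {x : ℕ → ℕ} (hle : ∀ r, x r ≤ r) (s : ℕ) :
    seg ℓ M x s s ≤ ℓ * cnt M x s := by
  unfold seg cnt
  rw [Finset.mul_sum]
  refine Finset.sum_le_sum fun r _ => ?_
  have := wt_le (ℓ := ℓ) (hle r)
  split_ifs <;> omega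

/-- A sum over slots is at most `ℓ` times the number of slots in a finite set that contains all
slots where the first summand exceeds the second one. -/
theorem sum_le_sum_add_card {ℓ M : ℕ} {f g : ℕ → ℕ} (S : Finset ℕ)
    (h : ∀ r, r ∉ S → f r ≤ g r) (h' : ∀ r ∈ S, f r ≤ g r + ℓ) :
    ∑ r ∈ Finset.range M, f r ≤ (∑ r ∈ Finset.range M, g r) + ℓ * S.card := by
  have h1 : ∀ r, f r ≤ g r + if r ∈ S then ℓ else 0 := fun r => by
    split_ifs with hr
    · exact h' r hr
    · exact h r hr
  calc ∑ r ∈ Finset.range M, f r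
      ≤ ∑ r ∈ Finset.range M, (g r + if r ∈ S then ℓ else 0) := Finset.sum_le_sum fun r _ => h1 r
    _ = (∑ r ∈ Finset.range M, g r) + ∑ r ∈ Finset.range M, if r ∈ S then ℓ else 0 :=
        Finset.sum_add_distrib
    _ ≤ _ := by
        gcongr
        rw [← Finset.sum_filter, Finset.sum_const, smul_eq_mul, mul_comm]
        gcongr
        intro r hr
        exact (Finset.mem_filter.1 hr).2

theorem mval_eq_seg {ℓ M T : ℕ} {x : ℕ → ℕ} (h : ∀ r < M, x r ≤ T) :
    mval ℓ M x = seg ℓ M x 1 T := by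
  refine Finset.sum_congr rfl fun r hr => ?_
  have := h r (Finset.mem_range.1 hr)
  split_ifs with h1
  · rfl
  · rw [show x r = 0 by omega, wt_zero]

/-! ### The period that owns a slot -/

/-- Some request of period `s` is quoted the slot `r`. -/
def Quotes (e : ℕ → ℕ) (a : ℕ → Action) (s r : ℕ) : Prop :=
  ∃ i ∈ Finset.Icc 1 (e s), a s i = (r : ℕ∞)

open Classical in
/-- The period whose request collects the reward of slot `r` (`0` if there is none). -/
noncomputable def own (e : ℕ → ℕ) (a : ℕ → Action) (r : ℕ) : ℕ :=
  if h : ∃ s, 1 ≤ s ∧ s ≤ r ∧ Quotes e a s r then Nat.find h else 0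

theorem own_le (e : ℕ → ℕ) (a : ℕ → Action) (r : ℕ) : own e a r ≤ r := by
  classical
  unfold own
  split_ifs with h
  · exact (Nat.find_spec h).2.1
  · exact Nat.zero_le _

theorem own_quotes {e : ℕ → ℕ} {a : ℕ → Action} {r : ℕ} (h0 : own e a r ≠ 0) :
    Quotes e a (own e a r) r := by
  classical
  unfold own at h0 ⊢
  split_ifs at h0 ⊢ with h
  · exact (Nat.find_spec h).2.2
  · exact absurd rfl h0

theorem own_eq_iff {e : ℕ → ℕ} {a : ℕ → Action} {r s : ℕ} (hs : 1 ≤ s) :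
    own e a r = s ↔ s ≤ r ∧ Quotes e a s r ∧ ∀ j, 1 ≤ j → j < s → ¬ Quotes e a j r := by
  classical
  constructor
  · rintro rfl
    refine ⟨own_le _ _ _, own_quotes (by omega), fun j hj hjs hq => ?_⟩
    have hle := own_le e a r
    unfold own at hjs hs hle
    split_ifs at hjs hs with h
    · exact Nat.find_min h hjs ⟨hj, (hjs.trans_le (Nat.find_spec h).2.1).le, hq⟩
    · omega
  · rintro ⟨h1, h2, h3⟩
    have h : ∃ s, 1 ≤ s ∧ s ≤ r ∧ Quotes e a s r := ⟨s, hs, h1, h2⟩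
    rw [own, dif_pos h, Nat.find_eq_iff]
    exact ⟨⟨hs, h1, h2⟩, fun n hn hq => h3 n hq.1 hn hq.2.2⟩

theorem own_ne_zero_iff {e : ℕ → ℕ} {a : ℕ → Action} {r : ℕ} :
    own e a r ≠ 0 ↔ ∃ s, 1 ≤ s ∧ s ≤ r ∧ Quotes e a s r := by
  classical
  constructor
  · exact fun h => ⟨_, Nat.one_le_iff_ne_zero.2 h, own_le _ _ _, own_quotes h⟩
  · intro h
    rw [own, dif_pos h]
    exact Nat.one_le_iff_ne_zero.1 (Nat.find_spec h).1

/-- In the double sum only one term can survive: the first request quoting `r` in the earliest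
period that quotes `r`. -/
theorem reward_eq (ℓ : ℕ) (e : ℕ → ℕ) (a : ℕ → Action) (r : ℕ) :
    reward ℓ e a r = (wt ℓ (own e a r) r : ℝ) := by
  classical
  unfold reward
  by_cases h0 : own e a r = 0
  · rw [h0, wt_zero, Nat.cast_zero]
    refine Finset.sum_eq_zero fun s hs => Finset.sum_eq_zero fun i hi => if_neg fun h => ?_
    rw [Finset.mem_Icc] at hs
    exact own_ne_zero_iff.2 ⟨s, hs.1, hs.2, i, hi, h.1⟩ h0
  · have h1 : 1 ≤ own e a r := by omega
    obtain ⟨hle, hq, hmin⟩ := (own_eq_iff h1).1 rfl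
    set s := own e a r with hs
    have hq' : ∃ i, i ∈ Finset.Icc 1 (e s) ∧ a s i = (r : ℕ∞) := hq
    obtain ⟨hi, hir⟩ := Nat.find_spec hq'
    set i := Nat.find hq' with hidef
    have himin : ∀ k ∈ Finset.Ico 1 i, a s k ≠ (r : ℕ∞) := fun k hk hkr => by
      rw [Finset.mem_Ico] at hk
      rw [Finset.mem_Icc] at hi
      exact Nat.find_min hq' hk.2 ⟨Finset.mem_Icc.2 ⟨hk.1, by omega⟩, hkr⟩
    rw [Finset.sum_eq_single s, Finset.sum_eq_single i, if_pos, wt_of_ne h0]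
    · refine ⟨hir, fun j hj k hk hjk => ?_, himin⟩
      rw [Finset.mem_Ico] at hj
      exact hmin j hj.1 hj.2 ⟨k, hk, hjk⟩
    · refine fun k hk hki => if_neg fun h => ?_
      rcases lt_or_gt_of_ne hki with hlt | hlt
      · exact himin k (Finset.mem_Ico.2 ⟨(Finset.mem_Icc.1 hk).1, hlt⟩) h.1
      · exact h.2.2 i (Finset.mem_Ico.2 ⟨(Finset.mem_Icc.1 hi).1, hlt⟩) hir
    · exact fun h => absurd hi h
    · refine fun j hj hjs => Finset.sum_eq_zero fun k hk => if_neg fun h => ?_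
      rw [Finset.mem_Icc] at hj
      rcases lt_or_gt_of_ne hjs with hlt | hlt
      · exact hmin j hj.1 hlt ⟨k, hk, h.1⟩
      · exact h.2.1 s (Finset.mem_Ico.2 ⟨h1, hlt⟩) i hi hir
    · exact fun h => absurd (Finset.mem_Icc.2 ⟨h1, hle⟩) h

theorem card_le_of_quotes {M : ℕ} {e : ℕ → ℕ} {a : ℕ → Action} {x : ℕ → ℕ} {s : ℕ}
    (h : ∀ r, x r = s → Quotes e a s r) : cnt M x s ≤ e s := by
  rw [cnt_eq_card]
  calc _ ≤ ((Finset.Icc 1 (e s)).image fun i => (a s i).toNat).card := by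
        refine Finset.card_le_card fun r hr => ?_
        obtain ⟨i, hi, hir⟩ := h r (Finset.mem_filter.1 hr).2
        exact Finset.mem_image.2 ⟨i, hi, by rw [hir]; rfl⟩
    _ ≤ (Finset.Icc 1 (e s)).card := Finset.card_image_le
    _ = e s := by simp

/-- This lets any action sequence act as the competitor: all upper bounds below are proved for
feasible matchings. -/
theorem feas_own (M : ℕ) (e : ℕ → ℕ) (a : ℕ → Action) :
    Feas M (fun _ => False) e (own e a) where
  free _ _ := id
  le := own_le e a
  cap s hs := card_le_of_quotes (a := a) fun r hr => by
    have := own_quotes (e := e) (a := a) (r := r) (by omega)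
    rwa [hr] at this

theorem own_le_horizon {e : ℕ → ℕ} {T : ℕ} (hT : ∀ s, T < s → e s = 0) (a : ℕ → Action) (r : ℕ) :
    own e a r ≤ T := by
  by_contra! h
  obtain ⟨i, hi, -⟩ := own_quotes (e := e) (a := a) (r := r) (by omega)
  rw [hT _ h, Finset.mem_Icc] at hi
  omega

/-- Requests arriving by `T` pay nothing from slot `T + ℓ` on, so the series is a finite sum. Slot
`0` has no owner and may be added. -/
theorem val_eq {ℓ : ℕ} {e : ℕ → ℕ} {T : ℕ} (hT : ∀ s, T < s → e s = 0) (a : ℕ → Action) :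
    val ℓ e a = (mval ℓ (T + ℓ) (own e a) : ℝ) := by
  have h0 : ∀ r, T + ℓ ≤ r → reward ℓ e a r = 0 := fun r hr => by
    have := own_le_horizon hT a r
    rw [reward_eq, Nat.cast_eq_zero, wt]
    split_ifs <;> omega
  have h00 : reward ℓ e a 0 = 0 := by simp [reward]
  unfold val
  rw [tsum_eq_sum (s := Finset.range (T + ℓ)) fun t ht => h0 _ (by
    rw [Finset.mem_range] at ht; omega)]
  have := Finset.sum_range_succ' (reward ℓ e a) (T + ℓ)
  rw [h00, add_zero, Finset.sum_range_succ, h0 _ le_rfl, add_zero] at this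
  rw [← this, mval, Nat.cast_sum]
  exact Finset.sum_congr rfl fun r _ => reward_eq ℓ e a r

theorem reserved_iff {e : ℕ → ℕ} {a : ℕ → Action} {m r : ℕ} :
    Reserved e a m r ↔ ∃ j, 1 ≤ j ∧ j ≤ m ∧ Quotes e a j r := by
  unfold Reserved Quotes
  simp only [Finset.mem_Icc]
  exact ⟨fun ⟨j, hj, h⟩ => ⟨j, hj.1, hj.2, h⟩, fun ⟨j, h1, h2, h⟩ => ⟨j, ⟨h1, h2⟩, h⟩⟩

theorem own_eq_iff_reserved {e : ℕ → ℕ} {a : ℕ → Action} {r t : ℕ} :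
    own e a r = t + 1 ↔ t + 1 ≤ r ∧ Quotes e a (t + 1) r ∧ ¬ Reserved e a t r := by
  rw [own_eq_iff (by omega), reserved_iff]
  refine and_congr_right fun _ => and_congr_right fun _ => ⟨?_, ?_⟩
  · rintro h ⟨j, h1, h2, h3⟩
    exact h j h1 (by omega) h3
  · exact fun h j h1 h2 h3 => h ⟨j, h1, by omega, h3⟩

theorem reserved_succ {e : ℕ → ℕ} {a : ℕ → Action} {r t : ℕ} :
    Reserved e a (t + 1) r ↔ Reserved e a t r ∨ Quotes e a (t + 1) r := by
  simp only [reserved_iff]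
  constructor
  · rintro ⟨j, h1, h2, h3⟩
    rcases Nat.lt_or_ge t j with h | h
    · right; rwa [show t + 1 = j by omega]
    · exact Or.inl ⟨j, h1, h, h3⟩
  · rintro (⟨j, h1, h2, h3⟩ | h)
    · exact ⟨j, h1, by omega, h3⟩
    · exact ⟨t + 1, by omega, le_rfl, h⟩

theorem reserved_mono {e : ℕ → ℕ} {a : ℕ → Action} {r t t' : ℕ} (h : t ≤ t')
    (hr : Reserved e a t r) : Reserved e a t' r := by
  rw [reserved_iff] at hr ⊢
  obtain ⟨j, h1, h2, h3⟩ := hr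
  exact ⟨j, h1, h2.trans h, h3⟩

theorem quotes_congr {e e' : ℕ → ℕ} {a a' : ℕ → Action} {s r : ℕ} (he : e s = e' s)
    (ha : a s = a' s) : Quotes e a s r ↔ Quotes e' a' s r := by
  unfold Quotes; rw [he, ha]

theorem reserved_congr {e e' : ℕ → ℕ} {a a' : ℕ → Action} {m r : ℕ}
    (he : ∀ s, 1 ≤ s → s ≤ m → e s = e' s) (ha : ∀ s, 1 ≤ s → s ≤ m → a s = a' s) :
    Reserved e a m r ↔ Reserved e' a' m r := by
  simp only [reserved_iff]
  constructor
  · rintro ⟨j, h1, h2, h3⟩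
    exact ⟨j, h1, h2, (quotes_congr (he j h1 h2) (ha j h1 h2)).1 h3⟩
  · rintro ⟨j, h1, h2, h3⟩
    exact ⟨j, h1, h2, (quotes_congr (he j h1 h2) (ha j h1 h2)).2 h3⟩

theorem own_congr {e e' : ℕ → ℕ} {a a' : ℕ → Action} {r : ℕ}
    (he : ∀ s, 1 ≤ s → s ≤ r → e s = e' s) (ha : ∀ s, 1 ≤ s → s ≤ r → a s = a' s) :
    own e a r = own e' a' r := by
  have key : ∀ {e e' : ℕ → ℕ} {a a' : ℕ → Action}, (∀ s, 1 ≤ s → s ≤ r → e s = e' s) →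
      (∀ s, 1 ≤ s → s ≤ r → a s = a' s) → own e a r ≠ 0 → own e' a' r = own e a r := by
    intro e e' a a' he ha h
    have h1 : 1 ≤ own e a r := by omega
    obtain ⟨h2, h3, h4⟩ := (own_eq_iff h1).1 rfl
    rw [own_eq_iff h1]
    refine ⟨h2, (quotes_congr (he _ h1 h2) (ha _ h1 h2)).1 h3, fun j hj hjs hq => ?_⟩
    exact h4 j hj hjs ((quotes_congr (he j hj (by omega)) (ha j hj (by omega))).2 hq)
  by_cases h : own e a r = 0
  · by_contra hne
    exact hne (key (fun s h1 h2 => (he s h1 h2).symm) (fun s h1 h2 => (ha s h1 h2).symm)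
      (fun h' => hne (h.trans h'.symm)))
  · exact (key he ha h).symm

/-! ### The constant `η` -/

/-- The defining equation of `γ*`: with g = γ*ℓ it is equivalent to g(ℓ+1) = (ℓ+g)(ℓ-g+1), which
says that the two terms of the minimum in `eta` coincide before rounding. -/
theorem gammaStar_mul_sq {ℓ : ℕ} (hℓ : 1 ≤ ℓ) :
    (gammaStar ℓ * ℓ) ^ 2 + gammaStar ℓ * ℓ * ℓ = (ℓ : ℝ) ^ 2 + ℓ := by
  have h0 : (0 : ℝ) < ℓ := by exact_mod_cast hℓ
  have h := Real.sq_sqrt (show (0 : ℝ) ≤ 5 / 4 + 1 / (ℓ : ℝ) by positivity)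
  unfold gammaStar
  have : (√(5 / 4 + 1 / (ℓ : ℝ)) - 1 / 2) ^ 2 + (√(5 / 4 + 1 / (ℓ : ℝ)) - 1 / 2) = 1 + 1 / ℓ := by
    linear_combination h
  calc _ = ((√(5 / 4 + 1 / (ℓ : ℝ)) - 1 / 2) ^ 2 + (√(5 / 4 + 1 / (ℓ : ℝ)) - 1 / 2))
        * (ℓ : ℝ) ^ 2 := by ring
    _ = _ := by rw [this]; field_simp

theorem gammaStar_pos {ℓ : ℕ} : 0 < gammaStar ℓ := by
  have : (1 : ℝ) ≤ √(5 / 4 + 1 / (ℓ : ℝ)) := by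
    rw [Real.one_le_sqrt]
    have : (0 : ℝ) ≤ 1 / (ℓ : ℝ) := by positivity
    linarith
  unfold gammaStar
  linarith

theorem gammaStar_mul_bounds {ℓ : ℕ} (hℓ : 1 ≤ ℓ) :
    (ℓ + 1 : ℝ) / 2 ≤ gammaStar ℓ * ℓ ∧ gammaStar ℓ * ℓ ≤ (2 * ℓ + 1 : ℝ) / 3
      ∧ gammaStar ℓ * ℓ ≤ ℓ := by
  have h1 : (1 : ℝ) ≤ ℓ := by exact_mod_cast hℓ
  have hg := gammaStar_mul_sq hℓ
  have hp : 0 < gammaStar ℓ * ℓ := mul_pos gammaStar_pos (by linarith)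
  set g := gammaStar ℓ * ℓ
  refine ⟨?_, ?_, ?_⟩ <;> by_contra! h <;> nlinarith

/-- The constant 4/9 is what the robustness account needs: it bounds the error budget 2(ℓ+1)/η of a
predictive phase by 9(ℓ+1)/2. -/
theorem eta_bounds {ℓ : ℕ} (hℓ : 1 ≤ ℓ) : (4 : ℝ) / 9 ≤ eta ℓ ∧ eta ℓ ≤ 1 := by
  have h1 : (1 : ℝ) ≤ ℓ := by exact_mod_cast hℓ
  obtain ⟨ha, hb, hc⟩ := gammaStar_mul_bounds hℓ
  unfold eta
  set g := gammaStar ℓ * ℓ with hg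
  refine ⟨le_min ?_ ?_, (min_le_left _ _).trans ?_⟩
  · rw [le_div_iff₀ (by linarith)]
    have h2 : ((ℓ / 2 : ℕ) : ℤ) + ((ℓ % 2 : ℕ) : ℤ) ≤ ⌊g⌋ := by
      rw [Int.le_floor]
      have h3 : ((ℓ / 2 : ℕ) : ℝ) * 2 + ((ℓ % 2 : ℕ) : ℝ) = ℓ := by
        exact_mod_cast Nat.div_add_mod' ℓ 2
      have h4 : ((ℓ % 2 : ℕ) : ℝ) ≤ 1 := by
        exact_mod_cast Nat.lt_succ_iff.1 (Nat.mod_lt ℓ two_pos)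
      rw [Int.cast_add, Int.cast_natCast, Int.cast_natCast]
      linarith
    have h5 : (ℓ : ℤ) ≤ 2 * ⌊g⌋ := by omega
    have h6 : (ℓ : ℝ) ≤ 2 * (⌊g⌋ : ℝ) := by exact_mod_cast h5
    linarith
  · rw [le_div_iff₀ (by nlinarith)]
    have h2 : (⌈g⌉ : ℝ) ≤ (2 * ℓ + 3) / 3 := by
      have h3 : 3 * ⌈g⌉ ≤ 2 * (ℓ : ℤ) + 3 := by
        have h4 : (⌈g⌉ : ℝ) < g + 1 := Int.ceil_lt_add_one g
        have h5 : (3 * ⌈g⌉ : ℝ) < 2 * ℓ + 4 := by linarith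
        have h6 : 3 * ⌈g⌉ < 2 * (ℓ : ℤ) + 4 := by exact_mod_cast h5
        omega
      have h4 : (3 * ⌈g⌉ : ℝ) ≤ 2 * ℓ + 3 := by exact_mod_cast h3
      linarith
    have h3 : g ≤ (⌈g⌉ : ℝ) := Int.le_ceil g
    -- The left side equals ℓ(5ℓ+3)/9, which is at least 4ℓ(ℓ+1)/9 because ℓ ≥ 1.
    have h4 : ((ℓ : ℝ) + (2 * ℓ + 3) / 3) * (ℓ - (2 * ℓ + 3) / 3 + 1)
        ≤ (ℓ + ⌈g⌉) * (ℓ - ⌈g⌉ + 1) := by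
      nlinarith
    nlinarith
  · rw [div_le_one (by linarith)]
    exact (Int.floor_le g).trans hc

/-- The least reward for which Q-FRAC* accepts a request. -/
noncomputable def threshold (ℓ : ℕ) : ℕ := ⌈eta ℓ * ℓ⌉₊

/-- The first term of the minimum gives k ≤ ⌊γ*ℓ⌋, and (ℓ+k)(ℓ-k+1) decreases in k for k ≥ 1, so the
bound that the second term gives at ⌈γ*ℓ⌉ passes to k. -/
theorem threshold_spec {ℓ : ℕ} (hℓ : 1 ≤ ℓ) :
    1 ≤ threshold ℓ ∧ threshold ℓ ≤ ℓ ∧ eta ℓ * ℓ ≤ threshold ℓ ∧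
      eta ℓ * (ℓ * (ℓ + 1)) ≤ ((ℓ : ℝ) + threshold ℓ) * (ℓ - threshold ℓ + 1) := by
  have h1 : (1 : ℝ) ≤ ℓ := by exact_mod_cast hℓ
  obtain ⟨ha, hb, hc⟩ := gammaStar_mul_bounds hℓ
  have he := eta_bounds hℓ
  have hpos : 0 < eta ℓ * ℓ := by nlinarith
  have hk1 : 1 ≤ threshold ℓ := Nat.one_le_iff_ne_zero.2 (Nat.ceil_pos.2 hpos).ne'
  have hk1' : (1 : ℝ) ≤ threshold ℓ := by exact_mod_cast hk1
  have hkl : threshold ℓ ≤ ℓ := Nat.ceil_le.2 (by nlinarith)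
  refine ⟨hk1, hkl, Nat.le_ceil _, ?_⟩
  have hkf : (threshold ℓ : ℤ) ≤ ⌊gammaStar ℓ * ℓ⌋ := by
    have h2 : eta ℓ * ℓ ≤ (⌊gammaStar ℓ * ℓ⌋ : ℝ) := by
      rw [← le_div_iff₀ (by linarith)]
      exact min_le_left _ _
    have h3 : 0 ≤ ⌊gammaStar ℓ * ℓ⌋ := Int.floor_nonneg.2 (by linarith)
    obtain ⟨n, hn⟩ := Int.eq_ofNat_of_zero_le h3
    rw [hn] at h2 ⊢
    exact_mod_cast Nat.ceil_le.2 (by exact_mod_cast h2)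
  have hkm : (threshold ℓ : ℤ) ≤ ⌈gammaStar ℓ * ℓ⌉ := hkf.trans (Int.floor_le_ceil _)
  have hkm' : (threshold ℓ : ℝ) ≤ (⌈gammaStar ℓ * ℓ⌉ : ℝ) := by exact_mod_cast hkm
  have h2 : eta ℓ * (ℓ * (ℓ + 1)) ≤
      ((ℓ : ℝ) + ⌈gammaStar ℓ * ℓ⌉) * ((ℓ : ℝ) - ⌈gammaStar ℓ * ℓ⌉ + 1) := by
    rw [← le_div_iff₀ (by nlinarith)]
    exact min_le_right _ _
  nlinarith

theorem qfracCount_eq {ℓ : ℕ} (hℓ : 1 ≤ ℓ) (t U x : ℕ) :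
    qfracCount ℓ t U x = min x (t + ℓ + 1 - (U + threshold ℓ)) := by
  have h0 : 0 ≤ eta ℓ * ℓ := mul_nonneg (by linarith [eta_bounds hℓ]) (Nat.cast_nonneg ℓ)
  unfold qfracCount threshold
  congr 1
  refine eq_of_forall_le_iff fun m => ?_
  rcases Nat.eq_zero_or_pos m with rfl | hm
  · simp
  · rw [Nat.le_floor_iff' hm.ne']
    constructor
    · intro h
      have h2 : ((m + U : ℕ) : ℝ) ≤ (t + ℓ + 1 : ℕ) := by push_cast; linarith
      have h2 : m + U ≤ t + ℓ + 1 := by exact_mod_cast h2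
      have h3 : ⌈eta ℓ * ℓ⌉₊ ≤ t + ℓ + 1 - (m + U) := by
        rw [Nat.ceil_le, Nat.cast_sub h2]
        push_cast
        linarith
      omega
    · intro h
      have h3 : ((m + (U + ⌈eta ℓ * ℓ⌉₊) : ℕ) : ℝ) ≤ (t + ℓ + 1 : ℕ) := by
        exact_mod_cast (by omega : m + (U + ⌈eta ℓ * ℓ⌉₊) ≤ t + ℓ + 1)
      have h4 := Nat.le_ceil (eta ℓ * ℓ)
      push_cast at h3
      linarith

/-! ### The competitive ratio of Q-FRAC* -/

/-- Slot `r ≥ A` pays at most min(ℓ, t+ℓ-r), and earlier slots cannot serve these periods. Both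
sides are doubled to keep the triangular number integral. -/
theorem seg_le_tail {ℓ M : ℕ} {x : ℕ → ℕ} (hle : ∀ r, x r ≤ r) {A t : ℕ} (hA : 1 ≤ A) (hAt : A ≤ t) :
    2 * seg ℓ M x A t ≤ 2 * (ℓ * (t - A)) + ℓ * (ℓ + 1) := by
  have h1 : seg ℓ M x A t ≤ ∑ r ∈ Finset.Ico A (t + ℓ), min ℓ (t + ℓ - r) := by
    unfold seg
    rw [← Finset.sum_filter]
    calc _ ≤ ∑ r ∈ (Finset.range M).filter fun r => A ≤ x r ∧ x r ≤ t,
          if r ∈ Finset.Ico A (t + ℓ) then min ℓ (t + ℓ - r) else 0 := by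
          refine Finset.sum_le_sum fun r hr => ?_
          have h1 := (Finset.mem_filter.1 hr).2
          have h2 := hle r
          simp only [wt, Finset.mem_Ico]
          split_ifs <;> omega
      _ ≤ _ := by
          rw [← Finset.sum_filter]
          refine Finset.sum_le_sum_of_subset fun r hr => (Finset.mem_filter.1 hr).2
  have h2 : ∑ r ∈ Finset.Ico A (t + ℓ), min ℓ (t + ℓ - r)
      ≤ ℓ * (t - A) + ∑ j ∈ Finset.range (ℓ + 1), j := by
    rw [← Finset.sum_Ico_consecutive _ hAt (Nat.le_add_right t ℓ)]
    refine add_le_add ?_ ?_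
    · calc _ ≤ ∑ r ∈ Finset.Ico A t, ℓ := Finset.sum_le_sum fun r _ => min_le_left _ _
        _ = _ := by simp [mul_comm]
    · rw [Finset.sum_Ico_eq_sum_range, add_tsub_cancel_left, ← Finset.sum_range_reflect,
        Finset.sum_range_succ', add_zero]
      refine Finset.sum_le_sum fun j hj => ?_
      rw [Finset.mem_range] at hj
      omega
  have h3 := Finset.sum_range_id_mul_two (ℓ + 1)
  rw [Nat.add_sub_cancel] at h3
  nlinarith

/-- Lower bound for the reward of the slots `A, …, U - 1` in a run of Q-FRAC* that has no backlog
in period `A`. -/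
noncomputable def batch (ℓ A U : ℕ) : ℕ := ∑ r ∈ Finset.Ico A U, max (threshold ℓ) (A + ℓ - r)

/-- The first ℓ+1-k slots contribute at least ℓ, ℓ-1, …, k, and each of the other t-A slots at least
k. -/
theorem batch_full {ℓ A t : ℕ} (hℓ : 1 ≤ ℓ) (hAt : A ≤ t) :
    (ℓ + threshold ℓ) * (ℓ - threshold ℓ + 1) + 2 * (threshold ℓ * (t - A))
      ≤ 2 * batch ℓ A (t + ℓ + 1 - threshold ℓ) := by
  obtain ⟨hk1, hkl, -, -⟩ := threshold_spec hℓ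
  set k := threshold ℓ with hk
  unfold batch
  rw [← Finset.sum_Ico_consecutive _ (show A ≤ A + (ℓ + 1 - k) by omega)
    (show A + (ℓ + 1 - k) ≤ t + ℓ + 1 - k by omega), ← hk]
  have h1 : k * (t - A) ≤ ∑ r ∈ Finset.Ico (A + (ℓ + 1 - k)) (t + ℓ + 1 - k), max k (A + ℓ - r) := by
    calc k * (t - A) = ∑ r ∈ Finset.Ico (A + (ℓ + 1 - k)) (t + ℓ + 1 - k), k := by
          rw [Finset.sum_const, Nat.card_Ico, smul_eq_mul, mul_comm]
          congr 1
          omega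
      _ ≤ _ := Finset.sum_le_sum fun r _ => le_max_left _ _
  have h2 : ∑ j ∈ Finset.range (ℓ + 1 - k), (k + j)
      ≤ ∑ r ∈ Finset.Ico A (A + (ℓ + 1 - k)), max k (A + ℓ - r) := by
    rw [Finset.sum_Ico_eq_sum_range, add_tsub_cancel_left, ← Finset.sum_range_reflect]
    refine Finset.sum_le_sum fun j hj => ?_
    rw [Finset.mem_range] at hj
    omega
  have h3 := Finset.sum_range_id_mul_two (ℓ + 1 - k)
  rw [Finset.sum_add_distrib, Finset.sum_const, Finset.card_range, smul_eq_mul] at h2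
  obtain ⟨d, hd⟩ : ∃ d, ℓ = k + d := ⟨ℓ - k, by omega⟩
  rw [show ℓ + 1 - k = d + 1 by omega, Nat.add_sub_cancel] at h3
  rw [show ℓ + 1 - k = d + 1 by omega] at h2
  rw [show ℓ - k + 1 = d + 1 by omega, show ℓ + 1 - k = d + 1 by omega] 
  rw [show ℓ + 1 - k = d + 1 by omega] at h1
  rw [hd] at h1 h2 ⊢
  nlinarith

/-- Progress of a run of Q-FRAC* that starts in period `τ` without history: after period `t`, its
first unassigned slot is `U` and it has collected `q`. -/
structure Run (ℓ M : ℕ) (e : ℕ → ℕ) (τ t U q : ℕ) : Prop where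
  one_le : 1 ≤ τ
  le_succ : τ ≤ t + 1
  lt : t + 1 ≤ U
  le : U + threshold ℓ ≤ t + ℓ + 1
  ratio : ∀ x, Feas M (fun _ => False) e x → eta ℓ * seg ℓ M x τ t ≤ q
  backlog : ∀ x, Feas M (fun _ => False) e x → ∃ A, τ ≤ A ∧ A ≤ t + 1 ∧
    eta ℓ * seg ℓ M x τ (A - 1) + batch ℓ A U ≤ q

theorem run_init {ℓ M : ℕ} (hℓ : 1 ≤ ℓ) (e : ℕ → ℕ) (t : ℕ) : Run ℓ M e (t + 1) t (t + 1) 0 where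
  one_le := by omega
  le_succ := le_rfl
  lt := le_rfl
  le := by have := (threshold_spec hℓ).2.1; omega
  ratio x _ := by rw [seg_empty x (by omega)]; simp
  backlog x _ := ⟨t + 1, le_rfl, le_rfl, by
    rw [seg_empty x (by omega)]; simp [batch]⟩

/-- The two fields of `Run` serve the two cases: `ratio` extends over a period whose requests are
all accepted, `backlog` restores the ratio after a rejection. -/
theorem Run.step {ℓ M : ℕ} (hℓ : 1 ≤ ℓ) {e : ℕ → ℕ} {τ t U q : ℕ} (h : Run ℓ M e τ t U q) {N : ℕ}
    (hN : N = qfracCount ℓ (t + 1) U (e (t + 1))) :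
    Run ℓ M e τ (t + 1) (max (t + 2) (U + N))
      (q + ∑ r ∈ Finset.Ico U (U + N), (t + 1 + ℓ - r)) := by
  obtain ⟨hk1, hkl, hk2, hk3⟩ := threshold_spec hℓ
  obtain ⟨h1, h2, h3, h4, h5, h6⟩ := h
  rw [qfracCount_eq hℓ] at hN
  have he := eta_bounds hℓ
  have hk3' : eta ℓ * (ℓ * (ℓ + 1)) ≤
      (((ℓ + threshold ℓ) * (ℓ - threshold ℓ + 1) : ℕ) : ℝ) := by
    rw [Nat.cast_mul, Nat.cast_add, Nat.cast_add, Nat.cast_sub hkl]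
    exact_mod_cast hk3
  set k := threshold ℓ with hk
  set G := ∑ r ∈ Finset.Ico U (U + N), (t + 1 + ℓ - r) with hG
  have hNx : N ≤ e (t + 1) := by omega
  have hNk : U + N + k ≤ t + ℓ + 2 := by omega
  have hGk : N * k ≤ G := by
    calc N * k = ∑ r ∈ Finset.Ico U (U + N), k := by simp
      _ ≤ G := Finset.sum_le_sum fun r hr => by rw [Finset.mem_Ico] at hr; omega
  have hb : ∀ x, Feas M (fun _ => False) e x → ∃ A, τ ≤ A ∧ A ≤ t + 1 ∧
      eta ℓ * seg ℓ M x τ (A - 1) + batch ℓ A (U + N) ≤ ((q + G : ℕ) : ℝ) := by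
    intro x hx
    obtain ⟨A, hA1, hA2, hA3⟩ := h6 x hx
    refine ⟨A, hA1, hA2, ?_⟩
    have : batch ℓ A (U + N) ≤ batch ℓ A U + G := by
      unfold batch
      rw [← Finset.sum_Ico_consecutive _ (show A ≤ U by omega) (show U ≤ U + N by omega)]
      refine Nat.add_le_add_left (Finset.sum_le_sum fun r hr => ?_) _
      rw [Finset.mem_Ico] at hr
      omega
    have : (batch ℓ A (U + N) : ℝ) ≤ batch ℓ A U + G := by exact_mod_cast this
    push_cast
    linarith
  have hr : ∀ x, Feas M (fun _ => False) e x →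
      eta ℓ * seg ℓ M x τ (t + 1) ≤ ((q + G : ℕ) : ℝ) := by
    intro x hx
    -- With everything accepted, each of the N requests pays at least k ≥ ηℓ, while the competitor
    -- gets at most ℓ from each.
    rcases eq_or_lt_of_le hNx with hacc | hrej
    · rw [seg_add x h2 (Nat.le_succ t)]
      have h7 : (seg ℓ M x (t + 1) (t + 1) : ℝ) ≤ ℓ * N := by
        rw [hacc]
        exact_mod_cast (seg_self_le hx.le (t + 1)).trans
          (Nat.mul_le_mul_left _ (hx.cap _ (by omega)))
      have h8 := h5 x hx
      have h9 : (N : ℝ) * k ≤ G := by exact_mod_cast hGk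
      have h10 : eta ℓ * seg ℓ M x (t + 1) (t + 1) ≤ eta ℓ * (ℓ * N) := by
        gcongr
        linarith
      have h11 : eta ℓ * ℓ * N ≤ k * N := by gcongr
      push_cast
      nlinarith
    -- A rejection means that the acceptance limit is reached, U + N = t+ℓ+2-k, so the batch from A
    -- is full and `batch_full` can be set against `seg_le_tail`.
    · obtain ⟨A, hA1, hA2, hA3⟩ := hb x hx
      rw [seg_add x (show τ ≤ A - 1 + 1 by omega) (show A - 1 ≤ t + 1 by omega),
        Nat.sub_add_cancel (by omega)]
      have h7 := seg_le_tail (ℓ := ℓ) (M := M) hx.le (h1.trans hA1) hA2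
      have h8 := batch_full hℓ hA2
      rw [← hk, show t + 1 + ℓ + 1 - k = U + N by omega] at h8
      have h7' : (2 * seg ℓ M x A (t + 1) : ℝ)
          ≤ 2 * (ℓ * (t + 1 - A : ℕ)) + ℓ * (ℓ + 1) := by exact_mod_cast h7
      have h8' : (((ℓ + k) * (ℓ - k + 1) : ℕ) : ℝ) + 2 * (k * (t + 1 - A : ℕ))
          ≤ 2 * batch ℓ A (U + N) := by exact_mod_cast h8
      have h9 : eta ℓ * ℓ * (t + 1 - A : ℕ) ≤ k * (t + 1 - A : ℕ) := by gcongr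
      have h10 := mul_le_mul_of_nonneg_left h7' (show 0 ≤ eta ℓ by linarith)
      push_cast at hA3 ⊢ h10
      nlinarith
  refine ⟨h1, by omega, by omega, by omega, hr, fun x hx => ?_⟩
  rcases le_or_gt (t + 2) (U + N) with hU | hU
  · obtain ⟨A, hA1, hA2, hA3⟩ := hb x hx
    exact ⟨A, hA1, by omega, by rwa [max_eq_right hU]⟩
  -- No slot beyond period t+1 is assigned, so the backlog is gone and A restarts with an empty
  -- batch.
  · refine ⟨t + 2, by omega, le_rfl, ?_⟩
    rw [max_eq_left hU.le]
    simpa [batch] using hr x hx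

/-! ### Optimality of O-HRR* -/

/-- Giving slot `r` to a request of the latest possible period `i` is optimal. -/
theorem exists_exchange {ℓ M : ℕ} {x n : ℕ → ℕ} {r i : ℕ} (hr : r < M) (hi : 1 ≤ i)
    (hx : ∀ r', x r' ≠ 0 → r ≤ r') (hle : ∀ r, x r ≤ r) (hcap : ∀ s, 1 ≤ s → cnt M x s ≤ n s)
    (hmax : ∀ j, i < j → j ≤ r → n j = 0) :
    ∃ y : ℕ → ℕ, (∀ r', y r' ≠ 0 → r + 1 ≤ r') ∧ (∀ r, y r ≤ r) ∧
      (∀ r', y r' ≠ 0 → x r' ≠ 0) ∧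
      (∀ s, 1 ≤ s → cnt M y s ≤ if s = i then n s - 1 else n s) ∧
      mval ℓ M x ≤ mval ℓ M y + (i + ℓ - r) := by
  have hj : x r ≤ i := by
    by_contra! h
    have h1 := hmax _ h (hle r)
    have h2 := hcap (x r) (by omega)
    have h3 := cnt_pos (x := x) hr
    omega
  by_cases h : ∃ r', r < r' ∧ r' < M ∧ x r' = i
  -- The requests in slots r and r' are swapped. The truncated reward is convex, and pairing the
  -- later period with the earlier slot spreads the two arguments with their sum fixed. Slot r is
  -- then left out of `y`, its reward being the separate summand.
  · obtain ⟨r', h1, h2, h3⟩ := h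
    have hz : Function.update x r 0 r' = i := by rw [Function.update_of_ne (by omega), h3]
    refine ⟨Function.update (Function.update x r 0) r' (x r), ?_, ?_, ?_, ?_, ?_⟩
    · intro q hq
      by_contra! hlt
      rw [Function.update_of_ne (by omega)] at hq
      by_cases hqr : q = r
      · subst hqr; simp at hq
      · rw [Function.update_of_ne hqr] at hq
        have := hx q hq
        omega
    · intro q
      by_cases hq : q = r'
      · subst hq; rw [Function.update_self]; exact (hle r).trans h1.le
      · rw [Function.update_of_ne hq]
        by_cases hqr : q = r
        · subst hqr; simp
        · rw [Function.update_of_ne hqr]; exact hle q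
    · intro q hq
      by_cases hq' : q = r'
      · subst hq'; omega
      · rw [Function.update_of_ne hq'] at hq
        by_cases hqr : q = r
        · subst hqr; simp at hq
        · rwa [Function.update_of_ne hqr] at hq
    · intro s hs
      have e1 := cnt_update x hr 0 s
      have e2 := cnt_update (Function.update x r 0) h2 (x r) s
      rw [hz] at e2
      have e3 := hcap s hs
      rw [if_neg (show (0 : ℕ) ≠ s by omega)] at e1
      split_ifs at * <;> omega
    · have e1 := mval_update ℓ x hr 0
      have e2 := mval_update ℓ (Function.update x r 0) h2 (x r)
      rw [hz] at e2
      rw [wt_zero] at e1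
      rw [wt_of_ne (show i ≠ 0 by omega)] at e2
      unfold wt at e1 e2
      split_ifs at e1 e2 <;> omega
  -- Period i is served nowhere after r, so replacing the content of r by a request of i is free and
  -- no capacity of i remains in use.
  · push Not at h
    refine ⟨Function.update x r 0, ?_, ?_, ?_, ?_, ?_⟩
    · intro q hq
      by_cases hqr : q = r
      · subst hqr; simp at hq
      · rw [Function.update_of_ne hqr] at hq
        have := hx q hq
        omega
    · intro q
      by_cases hqr : q = r
      · subst hqr; simp
      · rw [Function.update_of_ne hqr]; exact hle q
    · intro q hq
      by_cases hqr : q = r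
      · subst hqr; simp at hq
      · rwa [Function.update_of_ne hqr] at hq
    · intro s hs
      have e1 := cnt_update x hr 0 s
      have e3 := hcap s hs
      rw [if_neg (show (0 : ℕ) ≠ s by omega)] at e1
      by_cases hsi : s = i
      · subst hsi
        have : cnt M (Function.update x r 0) s = 0 := by
          rw [cnt_eq_card, Finset.card_eq_zero, Finset.filter_eq_empty_iff]
          intro q hq hqs
          rw [Finset.mem_range] at hq
          by_cases hqr : q = r
          · subst hqr; rw [Function.update_self] at hqs; omega
          · rw [Function.update_of_ne hqr] at hqs
            exact h q (by have := hx q (by omega); omega) hq hqs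
        omega
      · rw [if_neg hsi]; omega
    · have e1 := mval_update ℓ x hr 0
      have : wt ℓ (x r) r ≤ i + ℓ - r := by unfold wt; split_ifs <;> omega
      omega

theorem mem_unscheduled {e : ℕ → ℕ} {a : ℕ → Action} {i j : ℕ} :
    j ∈ unscheduled e a i ↔ j ∈ Finset.Icc 1 (e i) ∧ a i j = ⊤ :=
  Finset.mem_filter

/-- The plan `a` of O-HRR* after the slots `m + 1, …, m + k`: `p` is the matching described by
`a`, and `y` completes it on the later slots to a matching that is at least as good as `x`. -/
structure Plan (ℓ M : ℕ) (e : ℕ → ℕ) (a0 : ℕ → Action) (m k : ℕ) (x : ℕ → ℕ) (a : ℕ → Action)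
    (p y : ℕ → ℕ) : Prop where
  old : ∀ j ≤ m, a j = a0 j
  supp : ∀ r, p r ≠ 0 → m < p r ∧ p r ≤ r ∧ r ≤ m + k ∧ r < p r + ℓ ∧ ¬ Reserved e a0 m r
  quote : ∀ i, m < i → ∀ j ∈ Finset.Icc 1 (e i), a i j = ⊤ ∨ ∃ r : ℕ, a i j = r ∧ p r = i
  quotes : ∀ r, p r ≠ 0 → Quotes e a (p r) r
  later : ∀ r, y r ≠ 0 → m + k < r ∧ ¬ Reserved e a0 m r
  le : ∀ r, y r ≤ r
  cap : ∀ s, 1 ≤ s → cnt M y s ≤ if m < s then (unscheduled e a s).card else 0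
  val : mval ℓ M x ≤ mval ℓ M p + mval ℓ M y

theorem plan_init {ℓ M : ℕ} {e : ℕ → ℕ} {a0 : ℕ → Action} {m : ℕ} {x : ℕ → ℕ}
    {sel : ℕ → Finset ℕ → ℕ} (hx : Feas M (Reserved e a0 m) (fun s => if m < s then e s else 0) x)
    (hxm : ∀ r, x r ≠ 0 → m < x r) :
    Plan ℓ M e a0 m 0 x (ohrr ℓ sel e a0 m 0) (fun _ => 0) x where
  old j hj := by simp [ohrr, hj]
  supp r h := absurd rfl h
  quote i hi j _ := Or.inl (by simp [ohrr, Nat.not_le.2 hi])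
  quotes r h := absurd rfl h
  later r h := ⟨(hxm r h).trans_le (hx.le r), hx.free r h⟩
  le := hx.le
  cap s hs := by
    refine (hx.cap s hs).trans ?_
    split_ifs with h
    · simp [unscheduled, ohrr, Nat.not_le.2 h]
    · exact le_rfl
  val := by simp

/-- A slot given away by the rule moves from `y` to `p` by the exchange argument; in the other cases
`p` is unchanged and `y` has nothing to lose in that slot. -/
theorem Plan.step {ℓ M : ℕ} {e : ℕ → ℕ} {a0 : ℕ → Action} {m k : ℕ} {x : ℕ → ℕ} {a : ℕ → Action}
    {p y : ℕ → ℕ} {sel : ℕ → Finset ℕ → ℕ} (hsel : ∀ r (S : Finset ℕ), S.Nonempty → sel r S ∈ S)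
    (h : Plan ℓ M e a0 m k x a p y) (hM : m + k + 1 < M) :
    ∃ p' y', Plan ℓ M e a0 m (k + 1) x (ohrrSlot ℓ sel e m a (m + k + 1)) p' y' := by
  obtain ⟨h1, h2, h3, h4, h5, h6, h7, h8⟩ := h
  have hp0 : p (m + k + 1) = 0 := by
    by_contra hne
    have := (h2 _ hne).2.2.1
    omega
  have hres : ∀ r, Reserved e a m r ↔ Reserved e a0 m r := fun r =>
    reserved_congr (fun _ _ _ => rfl) fun s _ hs => h1 s hs
  set r := m + k + 1 with hr
  unfold ohrrSlot
  split_ifs with hR hC <;> rw [hres] at hR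
  · refine ⟨p, y, h1, fun q hq => ?_, h3, h4, fun q hq => ?_, h6, h7, h8⟩
    · obtain ⟨g1, g2, g3, g4⟩ := h2 q hq
      exact ⟨g1, g2, by omega, g4⟩
    · obtain ⟨g1, g2⟩ := h5 q hq
      have : q ≠ r := fun h => g2 (h ▸ hR)
      exact ⟨by omega, g2⟩
  · set i := (candidates ℓ e a m r).max' hC with hi
    have hmem := Finset.max'_mem _ hC
    rw [← hi] at hmem
    simp only [candidates, Finset.mem_filter, Finset.mem_Icc] at hmem
    obtain ⟨⟨hi1, hi2⟩, hU⟩ := hmem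
    have hmi : m < i := by omega
    have hmax : ∀ j, i < j → j ≤ r → (if m < j then (unscheduled e a j).card else 0) = 0 := by
      intro j hj1 hj2
      rw [if_pos (by omega), Finset.card_eq_zero, ← Finset.not_nonempty_iff_eq_empty]
      intro hj
      have : j ∈ candidates ℓ e a m r := by
        simp only [candidates, Finset.mem_filter, Finset.mem_Icc]
        exact ⟨⟨by omega, hj2⟩, hj⟩
      have := Finset.le_max' _ _ this
      omega
    obtain ⟨y', g1, g2, g3, g4, g5⟩ := exists_exchange (ℓ := ℓ) hM (show 1 ≤ i by omega)
      (fun r' hr' => by have := (h5 r' hr').1; omega) h6 h7 hmax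
    have hj0 := hsel r _ hU
    set j0 := sel r (unscheduled e a i) with hj0def
    simp only [unscheduled, Finset.mem_filter] at hj0
    refine ⟨Function.update p r i, y', ?_, ?_, ?_, ?_, ?_, g2, ?_, ?_⟩
    · intro j hj
      rw [Function.update_of_ne (by omega), h1 j hj]
    · intro q hq
      by_cases hqr : q = r
      · subst hqr
        rw [Function.update_self]
        exact ⟨hmi, hi2, by omega, by omega, hR⟩
      · rw [Function.update_of_ne hqr] at hq ⊢
        obtain ⟨g1, g2, g3, g4⟩ := h2 q hq
        exact ⟨g1, g2, by omega, g4⟩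
    · intro s hs j hj
      have hold : (a s j = ⊤ ∨ ∃ q : ℕ, a s j = q ∧ p q = s) →
          (a s j = ⊤ ∨ ∃ q : ℕ, a s j = q ∧ Function.update p r i q = s) := by
        rintro (h | ⟨q, hq1, hq2⟩)
        · exact Or.inl h
        · refine Or.inr ⟨q, hq1, ?_⟩
          rwa [Function.update_of_ne]
          rintro rfl
          omega
      by_cases hsi : s = i
      · subst hsi
        rw [Function.update_self]
        by_cases hjj : j = j0
        · rw [hjj, Function.update_self]
          exact Or.inr ⟨r, rfl, by rw [Function.update_self]⟩
        · rw [Function.update_of_ne hjj]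
          exact hold (h3 _ hs j hj)
      · rw [Function.update_of_ne hsi]
        exact hold (h3 s hs j hj)
    · intro q hq
      by_cases hqr : q = r
      · subst hqr
        rw [Function.update_self]
        exact ⟨j0, hj0.1, by rw [Function.update_self, Function.update_self]⟩
      · rw [Function.update_of_ne hqr] at hq ⊢
        obtain ⟨j, hj, hjq⟩ := h4 q hq
        refine ⟨j, hj, ?_⟩
        by_cases hpi : p q = i
        · rw [hpi] at hjq ⊢
          rw [Function.update_self, Function.update_of_ne, hjq]
          rintro rfl
          rw [hj0.2] at hjq
          exact ENat.top_ne_natCast _ hjq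
        · rw [Function.update_of_ne hpi, hjq]
    · intro q hq
      exact ⟨by have := g1 q hq; omega, (h5 q (g3 q hq)).2⟩
    · intro s hs
      refine (g4 s hs).trans ?_
      by_cases hsi : s = i
      · subst hsi
        rw [if_pos rfl, if_pos hmi, if_pos hmi,
          ← Finset.card_erase_of_mem (show j0 ∈ unscheduled e a _ from hsel r _ hU)]
        refine Finset.card_le_card fun j hj => ?_
        rw [Finset.mem_erase, mem_unscheduled] at hj
        rw [mem_unscheduled, Function.update_self, Function.update_of_ne hj.1]
        exact hj.2
      · rw [if_neg hsi]
        simp only [unscheduled, Function.update_of_ne hsi]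
        exact le_rfl
    · have e1 := mval_update ℓ p hM i
      rw [hp0, wt_zero, wt_of_ne (show i ≠ 0 by omega)] at e1
      omega
  · refine ⟨p, Function.update y r 0, h1, ?_, h3, h4, ?_, ?_, ?_, ?_⟩
    · intro q hq
      obtain ⟨g1, g2, g3, g4⟩ := h2 q hq
      exact ⟨g1, g2, by omega, g4⟩
    · intro q hq
      by_cases hqr : q = r
      · subst hqr; simp at hq
      · rw [Function.update_of_ne hqr] at hq
        obtain ⟨g1, g2⟩ := h5 q hq
        exact ⟨by omega, g2⟩
    · intro q
      by_cases hqr : q = r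
      · subst hqr; simp
      · rw [Function.update_of_ne hqr]; exact h6 q
    · intro s hs
      have e1 := cnt_update y hM 0 s
      rw [if_neg (show (0 : ℕ) ≠ s by omega)] at e1
      exact le_trans (by omega) (h7 s hs)
    · have e1 := mval_update ℓ y hM 0
      -- A positive reward would put r in the window of a period with an unscheduled request, which
      -- would then be a candidate.
      have : wt ℓ (y r) r = 0 := by
        by_contra hne
        have hy0 : y r ≠ 0 := fun h => hne (by rw [h, wt_zero])
        rw [wt_of_ne hy0] at hne
        have hpos := cnt_pos (x := y) hM
        have hcap := h7 (y r) (by omega)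
        have hley := h6 r
        split_ifs at hcap with hmy
        · refine hC ⟨y r, ?_⟩
          simp only [candidates, Finset.mem_filter, Finset.mem_Icc]
          exact ⟨⟨by omega, hley⟩, Finset.card_pos.1 (by omega)⟩
        · omega
      omega

theorem exists_plan {ℓ M : ℕ} {e : ℕ → ℕ} {a0 : ℕ → Action} {m : ℕ} {x : ℕ → ℕ}
    {sel : ℕ → Finset ℕ → ℕ} (hsel : ∀ r (S : Finset ℕ), S.Nonempty → sel r S ∈ S)
    (hx : Feas M (Reserved e a0 m) (fun s => if m < s then e s else 0) x)
    (hxm : ∀ r, x r ≠ 0 → m < x r) (k : ℕ) (hM : m + k < M) :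
    ∃ p y, Plan ℓ M e a0 m k x (ohrr ℓ sel e a0 m k) p y := by
  induction k with
  | zero => exact ⟨_, _, plan_init hx hxm⟩
  | succ k ih =>
    obtain ⟨p, y, h⟩ := ih (by omega)
    exact h.step hsel hM

/-! ### The value of the best matching -/

/-- The largest total reward of a matching that avoids `B` and respects the capacities `n`. -/
noncomputable def best (ℓ M : ℕ) (B : ℕ → Prop) (n : ℕ → ℕ) : ℕ :=
  sSup {v | ∃ x, Feas M B n x ∧ mval ℓ M x = v}

theorem bddAbove_mval (ℓ M : ℕ) (B : ℕ → Prop) (n : ℕ → ℕ) :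
    BddAbove {v | ∃ x, Feas M B n x ∧ mval ℓ M x = v} := by
  refine ⟨M * ℓ, ?_⟩
  rintro _ ⟨x, hx, rfl⟩
  refine (Finset.sum_le_card_nsmul _ _ ℓ fun r _ => wt_le (hx.le r)).trans ?_
  simp

theorem le_best {ℓ M : ℕ} {B : ℕ → Prop} {n x : ℕ → ℕ} (hx : Feas M B n x) :
    mval ℓ M x ≤ best ℓ M B n :=
  le_csSup (bddAbove_mval ℓ M B n) ⟨x, hx, rfl⟩

theorem exists_best (ℓ M : ℕ) (B : ℕ → Prop) (n : ℕ → ℕ) :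
    ∃ x, Feas M B n x ∧ mval ℓ M x = best ℓ M B n ∧ ∀ r, x r ≠ 0 → r < M ∧ 1 ≤ n (x r) := by
  obtain ⟨x, hx, hv⟩ : best ℓ M B n ∈ {v | ∃ x, Feas M B n x ∧ mval ℓ M x = v} :=
    Nat.sSup_mem ⟨_, fun _ => 0, ⟨fun _ h => absurd rfl h, fun _ => Nat.zero_le _, fun s hs => by
      rw [cnt, Finset.sum_eq_zero fun r _ => if_neg (by omega)]; exact Nat.zero_le _⟩, rfl⟩
      (bddAbove_mval ℓ M B n)
  have hne : ∀ r, (if r < M then x r else 0) ≠ 0 → r < M ∧ (if r < M then x r else 0) = x r :=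
    fun r hr => by
      by_cases h : r < M
      · exact ⟨h, if_pos h⟩
      · rw [if_neg h] at hr; exact absurd rfl hr
  refine ⟨fun r => if r < M then x r else 0, ⟨fun r hr => ?_, fun r => ?_, fun s hs => ?_⟩, ?_, ?_⟩
  · have h := (hne r hr).2
    exact hx.free r (h ▸ hr)
  · split_ifs
    · exact hx.le r
    · exact Nat.zero_le _
  · exact (cnt_mono fun r hr => by rw [← (hne r (by omega)).2, hr]).trans (hx.cap s hs)
  · rw [← hv]
    exact Finset.sum_congr rfl fun r hr => by
      dsimp only
      rw [if_pos (Finset.mem_range.1 hr)]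
  · intro r hr
    obtain ⟨h1, h2⟩ := hne r hr
    refine ⟨h1, ?_⟩
    dsimp only at hr ⊢
    rw [h2] at hr ⊢
    exact (cnt_pos h1).trans (hx.cap _ (by omega))

/-- Removing a request decreases the value of the best matching by at most `ℓ`. -/
theorem best_le_add {ℓ M : ℕ} {B : ℕ → Prop} {n n' : ℕ → ℕ} (S : Finset ℕ)
    (hS : ∀ s ∈ S, 1 ≤ s)
    (h : ∀ s, 1 ≤ s → s ∉ S → n s ≤ n' s) :
    best ℓ M B n ≤ best ℓ M B n' + ℓ * ∑ s ∈ S, (n s - n' s) := by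
  obtain ⟨x, hx, hv, hM⟩ := exists_best ℓ M B n
  -- Of the slots serving s, as many as n' s permits are kept; the others are emptied, at a cost of
  -- at most ℓ each.
  have hK : ∀ s, ∃ K ⊆ (Finset.range M).filter fun r => x r = s,
      K.card = min (cnt M x s) (n' s) := fun s =>
    Finset.exists_subset_card_eq (by rw [← cnt_eq_card]; exact min_le_left _ _)
  choose K hK1 hK2 using hK
  have hsub : ∀ r, (if r ∈ K (x r) then x r else 0) ≠ 0 → r ∈ K (x r) := fun r hr => by
    by_contra hn
    rw [if_neg hn] at hr
    exact hr rfl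
  have hy : Feas M B n' fun r => if r ∈ K (x r) then x r else 0 := by
    refine ⟨fun r hr => ?_, fun r => ?_, fun s hs => ?_⟩
    · have := hsub r hr
      rw [if_pos this] at hr
      exact hx.free r hr
    · split_ifs
      · exact hx.le r
      · exact Nat.zero_le _
    · rw [cnt_eq_card]
      refine le_trans (Finset.card_le_card fun r hr => ?_) ((hK2 s).trans_le (min_le_right _ _))
      have h1 := (Finset.mem_filter.1 hr).2
      have h2 := hsub r (by omega)
      rw [if_pos h2] at h1
      rwa [h1] at h2
  have hmain : mval ℓ M x ≤ mval ℓ M (fun r => if r ∈ K (x r) then x r else 0)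
      + ℓ * (S.biUnion fun s => ((Finset.range M).filter fun r => x r = s) \ K s).card := by
    refine sum_le_sum_add_card _ (fun r hr => ?_) fun r _ => ?_
    · dsimp only
      split_ifs with hrK
      · exact le_rfl
      · by_cases h0 : x r = 0
        · rw [h0]
        · exfalso
          have hrM := (hM r h0).1
          by_cases hxS : x r ∈ S
          · exact hr (Finset.mem_biUnion.2 ⟨x r, hxS, by simp [hrM, hrK]⟩)
          · have h1 : cnt M x (x r) ≤ n' (x r) :=
              (hx.cap _ (by omega)).trans (h _ (by omega) hxS)
            have h2 : K (x r) = (Finset.range M).filter fun q => x q = x r :=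
              Finset.eq_of_subset_of_card_le (hK1 _) (by
                rw [hK2, min_eq_left h1, cnt_eq_card])
            exact hrK (by rw [h2]; simp [hrM])
    · have := wt_le (ℓ := ℓ) (hx.le r)
      omega
  have hcard : (S.biUnion fun s => ((Finset.range M).filter fun r => x r = s) \ K s).card
      ≤ ∑ s ∈ S, (n s - n' s) := by
    refine Finset.card_biUnion_le.trans (Finset.sum_le_sum fun s hs => ?_)
    rw [Finset.card_sdiff_of_subset (hK1 s), hK2, ← cnt_eq_card]
    have := hx.cap s (hS s hs)
    omega
  have h1 := le_best (ℓ := ℓ) hy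
  have h2 := Nat.mul_le_mul_left ℓ hcard
  omega

/-- Every quote made in the periods `1, …, t` lies in the window of its period. -/
def Valid (ℓ : ℕ) (e : ℕ → ℕ) (a : ℕ → Action) (t : ℕ) : Prop :=
  ∀ j, 1 ≤ j → j ≤ t → ∀ r, Quotes e a j r → j ≤ r ∧ r < j + ℓ

theorem Valid.reserved_lt {ℓ : ℕ} {e : ℕ → ℕ} {a : ℕ → Action} {t r : ℕ} (h : Valid ℓ e a t)
    (hr : Reserved e a t r) : r < t + ℓ := by
  obtain ⟨j, h1, h2, h3⟩ := reserved_iff.1 hr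
  have := (h j h1 h2 r h3).2
  omega

theorem Valid.succ {ℓ : ℕ} {e : ℕ → ℕ} {a : ℕ → Action} {t : ℕ} (h : Valid ℓ e a t)
    (h' : ∀ r, Quotes e a (t + 1) r → t + 1 ≤ r ∧ r < t + 1 + ℓ) : Valid ℓ e a (t + 1) := by
  intro j h1 h2 r hr
  rcases Nat.lt_or_ge t j with hj | hj
  · obtain rfl : j = t + 1 := by omega
    exact h' r hr
  · exact h j h1 hj r hr

/-! ### The predictive phase -/

theorem estimateM_bounds {ℓ t T : ℕ} {estar : ℕ → ℕ} (hℓ : 1 ≤ ℓ) (hT : ∀ s, T < s → estar s = 0) :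
    t ≤ estimateM ℓ t estar ∧ estimateM ℓ t estar ≤ max t T + ℓ - 1 ∧
      ∀ s, 1 ≤ s → 0 < estar s → s + ℓ - 1 ≤ estimateM ℓ t estar := by
  have hub : ∀ s ∈ {s | 1 ≤ s ∧ 0 < estar s}, s ≤ T := fun s hs => by
    by_contra! h
    have := hT s h
    have := hs.2
    omega
  have h1 : sSup {s | 1 ≤ s ∧ 0 < estar s} ≤ T := csSup_le' hub
  unfold estimateM
  refine ⟨by omega, by omega, fun s h2 h3 => ?_⟩
  have : s ≤ sSup {s | 1 ≤ s ∧ 0 < estar s} := le_csSup ⟨T, hub⟩ ⟨h2, h3⟩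
  omega

/-- The predicted requests after period `t`. -/
def future (estar : ℕ → ℕ) (t s : ℕ) : ℕ := if t < s then estar s else 0

/-- The optimal plan splits into the slots of period t+1, which are executed, and the rest, which is
feasible for the residual problem at t+1. The plan uses the true e (t+1) instead of the predicted
number, which costs ℓ per missing request. -/
theorem predictive_step {ℓ T : ℕ} (hℓ : 1 ≤ ℓ) {e estar e' : ℕ → ℕ} {a a0 : ℕ → Action} {t : ℕ}
    {sel : ℕ → Finset ℕ → ℕ} (hsel : ∀ r (S : Finset ℕ), S.Nonempty → sel r S ∈ S)
    (hT : ∀ s, T < s → estar s = 0) (htT : t + 1 ≤ T)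
    (he1 : ∀ s, 1 ≤ s → s ≤ t + 1 → e' s = e s) (he2 : ∀ s, t + 1 < s → e' s = estar s)
    (ha0 : ∀ s, 1 ≤ s → s ≤ t → a0 s = a s)
    (ha : a (t + 1) = ohrr ℓ sel e' a0 t (estimateM ℓ (t + 1) estar - t) (t + 1)) :
    (∀ r, Quotes e a (t + 1) r → t + 1 ≤ r ∧ r < t + 1 + ℓ) ∧
    best ℓ (T + ℓ) (Reserved e a t) (future estar t)
      ≤ seg ℓ (T + ℓ) (own e a) (t + 1) (t + 1)
        + best ℓ (T + ℓ) (Reserved e a (t + 1)) (future estar (t + 1))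
        + ℓ * (estar (t + 1) - e (t + 1)) := by
  obtain ⟨hM1, hM2, hM3⟩ := estimateM_bounds (t := t + 1) hℓ hT
  set m := estimateM ℓ (t + 1) estar with hm
  have hres : Reserved e' a0 t = Reserved e a t := by
    funext r
    exact propext (reserved_congr (fun s h1 h2 => he1 s h1 (by omega)) ha0)
  obtain ⟨x, hx, hxv, hxn⟩ := exists_best ℓ (T + ℓ) (Reserved e' a0 t)
    (fun s => if t < s then e' s else 0)
  obtain ⟨p, y, hp⟩ := exists_plan (ℓ := ℓ) hsel hx (fun r hr => by
    have := (hxn r hr).2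
    by_contra hlt
    simp only [if_neg hlt] at this
    omega) (m - t) (by omega)
  set plan := ohrr ℓ sel e' a0 t (m - t) with hplan
  have hquote : ∀ r, Quotes e a (t + 1) r ↔ p r = t + 1 := by
    intro r
    rw [quotes_congr (he1 (t + 1) (by omega) le_rfl).symm ha]
    constructor
    · rintro ⟨i, hi, hir⟩
      rcases hp.quote (t + 1) (by omega) i hi with h | ⟨q, h1, h2⟩
      · rw [hir] at h
        exact absurd h.symm (ENat.top_ne_natCast r)
      · rw [hir] at h1
        have : r = q := by exact_mod_cast h1
        rwa [this]
    · intro h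
      have := hp.quotes r (by omega)
      rwa [h] at this
  have hwin : ∀ r, Quotes e a (t + 1) r → t + 1 ≤ r ∧ r < t + 1 + ℓ := by
    intro r hr
    rw [hquote] at hr
    obtain ⟨h1, h2, h3, h4, h5⟩ := hp.supp r (by omega)
    omega
  refine ⟨hwin, ?_⟩
  have hown : ∀ r, own e a r = t + 1 ↔ p r = t + 1 := by
    intro r
    rw [own_eq_iff_reserved, hquote, ← hres]
    refine ⟨fun h => h.2.1, fun h => ?_⟩
    obtain ⟨h1, h2, h3, h4, h5⟩ := hp.supp r (by omega)
    exact ⟨by omega, h, h5⟩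
  -- The plan runs up to `estimateM`, after which every known or predicted request has expired, so
  -- the unplanned remainder is worthless.
  have hy0 : mval ℓ (T + ℓ) y = 0 := by
    refine Finset.sum_eq_zero fun r hr => ?_
    by_cases h0 : y r = 0
    · rw [h0, wt_zero]
    · rw [wt_of_ne h0]
      have h1 := (hp.later r h0).1
      have h2 := cnt_pos (x := y) (Finset.mem_range.1 hr)
      have h3 := hp.cap (y r) (by omega)
      split_ifs at h3 with h4
      · rcases Nat.lt_or_ge (t + 1) (y r) with h5 | h5
        · have h6 : (unscheduled e' plan (y r)).card ≤ e' (y r) := by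
            refine (Finset.card_filter_le _ _).trans ?_
            simp
          rw [he2 _ h5] at h6
          have := hM3 (y r) (by omega) (by omega)
          omega
        · have : t + 1 + ℓ - 1 ≤ m := by rw [hm, estimateM]; omega
          omega
      · omega
  have hnext : Feas (T + ℓ) (Reserved e a (t + 1)) (future estar (t + 1))
      (fun r => if p r = t + 1 then 0 else p r) := by
    have hne : ∀ r, (if p r = t + 1 then 0 else p r) ≠ 0 → p r ≠ t + 1 ∧ p r ≠ 0 := by
      intro r hr
      split_ifs at hr with h
      · exact absurd rfl hr
      · exact ⟨h, hr⟩
    refine ⟨fun r hr => ?_, fun r => ?_, fun s hs => ?_⟩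
    · obtain ⟨h1, h2⟩ := hne r hr
      rw [reserved_succ, hquote, ← hres]
      rintro (h | h)
      · exact (hp.supp r h2).2.2.2.2 h
      · exact h1 h
    · split_ifs
      · exact Nat.zero_le _
      · by_cases h : p r = 0
        · omega
        · exact (hp.supp r h).2.1
    · unfold future
      split_ifs with hts
      · rw [← he2 s hts]
        refine card_le_of_quotes (a := plan) fun r hr => ?_
        obtain ⟨h1, h2⟩ := hne r (by omega)
        rw [if_neg h1] at hr
        have := hp.quotes r h2
        rwa [hr] at this
      · rw [cnt_eq_card, Nat.le_zero, Finset.card_eq_zero, Finset.filter_eq_empty_iff]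
        intro r _ hr
        obtain ⟨h1, h2⟩ := hne r (by omega)
        rw [if_neg h1] at hr
        have := (hp.supp r h2).1
        omega
  have hsplit : mval ℓ (T + ℓ) p = seg ℓ (T + ℓ) (own e a) (t + 1) (t + 1)
      + mval ℓ (T + ℓ) (fun r => if p r = t + 1 then 0 else p r) := by
    unfold mval seg
    rw [← Finset.sum_add_distrib]
    refine Finset.sum_congr rfl fun r _ => ?_
    dsimp only
    by_cases h : p r = t + 1
    · rw [if_pos h, (hown r).2 h, if_pos ⟨le_rfl, le_rfl⟩, wt_zero, h, add_zero]
    · have : own e a r ≠ t + 1 := fun h' => h ((hown r).1 h')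
      rw [if_neg h, if_neg (by omega), zero_add]
  have h1 := hp.val
  have h2 := le_best (ℓ := ℓ) hnext
  have h3 := best_le_add (ℓ := ℓ) (M := T + ℓ) (B := Reserved e a t) (n := future estar t)
    (n' := fun s => if t < s then e' s else 0) {t + 1} (by simp) fun s hs hst => by
      rw [Finset.mem_singleton] at hst
      unfold future
      split_ifs with h
      · rw [he2 s (by omega)]
      · exact le_rfl
  rw [Finset.sum_singleton, future, if_pos (by omega), if_pos (by omega),
    he1 (t + 1) (by omega) le_rfl] at h3
  rw [hres] at hxv
  omega

/-- A predictive phase that consists of the periods `p + 1, …, q` loses at most `ℓ` per unit of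
prediction error, apart from the slots at its two ends. -/
theorem predictive_phase {ℓ M : ℕ} {e estar : ℕ → ℕ} {a : ℕ → Action} {p q : ℕ} (hpq : p ≤ q)
    (hval : Valid ℓ e a p)
    (h : best ℓ M (Reserved e a p) (future estar p)
      ≤ seg ℓ M (own e a) (p + 1) q + best ℓ M (Reserved e a q) (future estar q)
        + ℓ * ∑ s ∈ Finset.Ioc p q, (estar s - e s))
    {x : ℕ → ℕ} (hx : Feas M (fun _ => False) e x) :
    seg ℓ M x (p + 1) q ≤ seg ℓ M (own e a) (p + 1) q
      + ℓ * ∑ s ∈ Finset.Ioc p q, ((e s - estar s) + (estar s - e s)) + 2 * (ℓ * (ℓ - 1)) := by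
  obtain ⟨z, hz, hzv, hzn⟩ := exists_best ℓ M (Reserved e a q) (future estar q)
  have hzq : ∀ r, z r ≠ 0 → q < z r := fun r hr => by
    have := (hzn r hr).2
    unfold future at this
    split_ifs at this with h
    · exact h
    · omega
  -- The capacities are the true requests within the phase and the predicted ones after it; compared
  -- with pure predictions, only underprediction inside the phase costs anything.
  have h1 := best_le_add (ℓ := ℓ) (M := M) (B := Reserved e a p)
    (n := fun s => if s ≤ p then 0 else if s ≤ q then e s else estar s)
    (n' := future estar p) (Finset.Ioc p q) (fun s hs => by rw [Finset.mem_Ioc] at hs; omega)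
    fun s hs hsS => by
      rw [Finset.mem_Ioc] at hsS
      unfold future
      split_ifs <;> omega
  have h2 : ∑ s ∈ Finset.Ioc p q,
      ((if s ≤ p then 0 else if s ≤ q then e s else estar s) - future estar p s)
      = ∑ s ∈ Finset.Ioc p q, (e s - estar s) :=
    Finset.sum_congr rfl fun s hs => by
      rw [Finset.mem_Ioc] at hs
      rw [if_neg (by omega), if_pos hs.2, future, if_pos hs.1]
  rw [h2] at h1
  classical
  -- The competitor is followed up to slot q and an optimal solution of the residual problem after
  -- it. The value of that solution cancels the final potential in `h`.
  set y : ℕ → ℕ := fun r =>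
    if r ≤ q then (if p < x r ∧ ¬ Reserved e a p r then x r else 0) else z r with hy
  have hyf : Feas M (Reserved e a p)
      (fun s => if s ≤ p then 0 else if s ≤ q then e s else estar s) y := by
    have hcase : ∀ r, y r ≠ 0 → (r ≤ q ∧ p < x r ∧ ¬ Reserved e a p r ∧ y r = x r)
        ∨ (q < r ∧ y r = z r) := by
      intro r hr
      simp only [hy] at hr ⊢
      split_ifs at hr ⊢ with g1 g2
      · exact Or.inl ⟨g1, g2.1, g2.2, rfl⟩
      · exact absurd rfl hr
      · exact Or.inr ⟨by omega, rfl⟩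
    refine ⟨fun r hr => ?_, fun r => ?_, fun s hs => ?_⟩
    · rcases hcase r hr with ⟨-, -, g, -⟩ | ⟨g1, g2⟩
      · exact g
      · exact fun hres => hz.free r (g2 ▸ hr) (reserved_mono hpq hres)
    · have := hx.le r
      have := hz.le r
      by_cases h0 : y r = 0
      · omega
      · rcases hcase r h0 with ⟨-, -, -, g⟩ | ⟨-, g⟩ <;> omega
    · split_ifs with g1 g2
      · rw [cnt_eq_card, Nat.le_zero, Finset.card_eq_zero, Finset.filter_eq_empty_iff]
        intro r _ hr
        rcases hcase r (by omega) with ⟨_, g3, _, g⟩ | ⟨_, g⟩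
        · omega
        · have := hzq r (by omega); omega
      · refine (cnt_mono fun r hr => ?_).trans (hx.cap s hs)
        rcases hcase r (by omega) with ⟨_, g3, _, g⟩ | ⟨_, g⟩
        · omega
        · have := hzq r (by omega); omega
      · have g3 := hz.cap s hs
        rw [future, if_pos (by omega)] at g3
        refine (cnt_mono fun r hr => ?_).trans g3
        have := hx.le r
        rcases hcase r (by omega) with ⟨_, g3, _, g⟩ | ⟨_, g⟩ <;> omega
  have h3 := le_best (ℓ := ℓ) hyf
  -- The splice loses the competitor's reward only in two blocks of ℓ-1 slots: after p, where the
  -- history may hold reservations, and after q, where the competitor may still serve the phase.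
  have h4 : seg ℓ M x (p + 1) q + mval ℓ M z ≤ mval ℓ M y
      + ℓ * (Finset.Ico (p + 1) (p + ℓ) ∪ Finset.Ico (q + 1) (q + ℓ)).card := by
    unfold seg mval
    rw [← Finset.sum_add_distrib]
    refine sum_le_sum_add_card _ (fun r hr => ?_) fun r _ => ?_
    · rw [Finset.mem_union, Finset.mem_Ico, Finset.mem_Ico] at hr
      have hxr := hx.le r
      have hzr := hz.le r
      have hzr' := hzq r
      simp only [hy]
      by_cases hrq : r ≤ q
      · rw [if_pos hrq, show z r = 0 by by_contra h0; have := hzr' h0; omega, wt_zero, add_zero]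
        split_ifs with g1 g2
        · exact le_rfl
        · have g3 : Reserved e a p r := by
            by_contra g
            exact g2 ⟨by omega, g⟩
          have := hval.reserved_lt g3
          omega
        · exact Nat.zero_le _
        · exact Nat.zero_le _
      · rw [if_neg hrq]
        have : (if p + 1 ≤ x r ∧ x r ≤ q then wt ℓ (x r) r else 0) = 0 := by
          unfold wt
          split_ifs <;> omega
        omega
    · have hxr := wt_le (ℓ := ℓ) (hx.le r)
      have hzr := hz.le r
      have hzr' := hzq r
      simp only [hy]
      by_cases hrq : r ≤ q
      · rw [show z r = 0 by by_contra h0; have := hzr' h0; omega, wt_zero]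
        split_ifs <;> omega
      · rw [if_neg hrq]
        split_ifs <;> omega
  have h5 : (Finset.Ico (p + 1) (p + ℓ) ∪ Finset.Ico (q + 1) (q + ℓ)).card ≤ 2 * (ℓ - 1) := by
    refine (Finset.card_union_le _ _).trans ?_
    rw [Nat.card_Ico, Nat.card_Ico]
    omega
  have h6 := Nat.mul_le_mul_left ℓ h5
  rw [Finset.sum_add_distrib, Nat.mul_add]
  have h7 : ℓ * (2 * (ℓ - 1)) = 2 * (ℓ * (ℓ - 1)) := by ring
  omega

/-! ### The conservative phase -/

open Classical in
/-- The number of slots after period `m` that are reserved by the requests of the first `m`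
periods. -/
noncomputable def backlog (ℓ : ℕ) (e : ℕ → ℕ) (a : ℕ → Action) (m : ℕ) : ℕ :=
  ((Finset.Ico (m + 1) (m + ℓ)).filter (Reserved e a m)).card

theorem backlog_le (ℓ : ℕ) (e : ℕ → ℕ) (a : ℕ → Action) (m : ℕ) : backlog ℓ e a m ≤ ℓ - 1 := by
  refine (Finset.card_filter_le _ _).trans ?_
  rw [Nat.card_Ico]
  omega

theorem backlog_zero (ℓ : ℕ) (e : ℕ → ℕ) (a : ℕ → Action) : backlog ℓ e a 0 = 0 := by
  classical
  rw [backlog, Finset.card_eq_zero, Finset.filter_eq_empty_iff]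
  intro r _ hr
  obtain ⟨j, h1, h2, -⟩ := reserved_iff.1 hr
  omega

open Classical in
/-- The state of a conservative phase that started in period `m + 1`, after period `t`. -/
structure Conservative (ℓ M : ℕ) (e : ℕ → ℕ) (a : ℕ → Action) (m t U q : ℕ) : Prop where
  run : Run ℓ M e (m + 1) t U q
  slots : ∀ r, U ≤ r → Reserved e a t r → Reserved e a m r
  got : q ≤ seg ℓ M (own e a) (m + 1) t
    + ℓ * ((Finset.Ico (m + 1) U).filter (Reserved e a m)).card

theorem conservative_init {ℓ M : ℕ} (hℓ : 1 ≤ ℓ) (e : ℕ → ℕ) (a : ℕ → Action) (m : ℕ) :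
    Conservative ℓ M e a m m (m + 1) 0 where
  run := run_init hℓ e m
  slots _ _ h := h
  got := Nat.zero_le _

/-- Q-FRAC* ignores the history and may quote slots that are already taken. The amount `q` is what
it would collect without history; each taken slot accounts for a shortfall of at most ℓ. -/
theorem Conservative.step {ℓ T : ℕ} (hℓ : 1 ≤ ℓ) {e : ℕ → ℕ} {a : ℕ → Action} {m t U q : ℕ}
    (h : Conservative ℓ (T + ℓ) e a m t U q) (htT : t + 1 ≤ T)
    (ha : a (t + 1) = qfracAction U (qfracCount ℓ (t + 1) U (e (t + 1)))) :
    (∀ r, Quotes e a (t + 1) r → t + 1 ≤ r ∧ r < t + 1 + ℓ) ∧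
    ∃ q', Conservative ℓ (T + ℓ) e a m (t + 1)
      (max (t + 2) (U + qfracCount ℓ (t + 1) U (e (t + 1)))) q' := by
  classical
  have hk := (threshold_spec hℓ).1
  obtain ⟨h1, h2, h3⟩ := h
  have hN := qfracCount_eq hℓ (t + 1) U (e (t + 1))
  have hrun := h1.step hℓ (N := qfracCount ℓ (t + 1) U (e (t + 1))) rfl
  set N := qfracCount ℓ (t + 1) U (e (t + 1)) with hNdef
  have hU1 := h1.lt
  have hU2 := h1.le
  have hmt := h1.le_succ
  have hquote : ∀ r, Quotes e a (t + 1) r ↔ U ≤ r ∧ r < U + N := by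
    intro r
    unfold Quotes
    rw [ha]
    simp only [qfracAction, Finset.mem_Icc]
    constructor
    · rintro ⟨i, ⟨hi1, hi2⟩, hi⟩
      split_ifs at hi with hiN
      · have : U + i - 1 = r := by exact_mod_cast hi
        omega
      · exact absurd hi (ENat.top_ne_natCast r)
    · rintro ⟨g1, g2⟩
      refine ⟨r + 1 - U, ⟨by omega, by omega⟩, ?_⟩
      rw [if_pos (by omega), show U + (r + 1 - U) - 1 = r by omega]
  refine ⟨fun r hr => by rw [hquote] at hr; omega, _, hrun, fun r hr hres => ?_, ?_⟩
  · rw [reserved_succ, hquote] at hres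
    rcases hres with hres | hres
    · exact h2 r (by omega) hres
    · omega
  · have hG : ∑ r ∈ Finset.Ico U (U + N), (t + 1 + ℓ - r)
        ≤ seg ℓ (T + ℓ) (own e a) (t + 1) (t + 1)
          + ℓ * ((Finset.Ico U (U + N)).filter (Reserved e a m)).card := by
      have : ∑ r ∈ Finset.Ico U (U + N), (t + 1 + ℓ - r)
          ≤ ∑ r ∈ Finset.range (T + ℓ), if r ∈ Finset.Ico U (U + N) then t + 1 + ℓ - r else 0 := by
        rw [← Finset.sum_filter]
        refine Finset.sum_le_sum_of_subset fun r hr => ?_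
        rw [Finset.mem_filter, Finset.mem_range]
        refine ⟨?_, hr⟩
        rw [Finset.mem_Ico] at hr
        omega
      refine this.trans (sum_le_sum_add_card _ (fun r hr => ?_) fun r hr => ?_)
      · split_ifs with g1 g2 g2
        · have : own e a r ≠ 0 := by omega
          rw [wt_of_ne this]
          omega
        · refine absurd ?_ g2
          rw [Finset.mem_filter, not_and] at hr
          have g3 := hr g1
          rw [Finset.mem_Ico] at g1
          have : own e a r = t + 1 := own_eq_iff_reserved.2
            ⟨by omega, (hquote r).2 g1, fun hres => g3 (h2 r g1.1 hres)⟩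
          omega
        · exact Nat.zero_le _
        · exact Nat.zero_le _
      · rw [Finset.mem_filter, Finset.mem_Ico] at hr
        split_ifs <;> omega
    have hcard : ((Finset.Ico (m + 1) U).filter (Reserved e a m)).card
        + ((Finset.Ico U (U + N)).filter (Reserved e a m)).card
        ≤ ((Finset.Ico (m + 1) (max (t + 2) (U + N))).filter (Reserved e a m)).card := by
      rw [← Finset.card_union_of_disjoint]
      · refine Finset.card_le_card fun r hr => ?_
        simp only [Finset.mem_union, Finset.mem_filter, Finset.mem_Ico] at hr ⊢
        rcases hr with hr | hr
        · exact ⟨by omega, hr.2⟩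
        · exact ⟨by omega, hr.2⟩
      · rw [Finset.disjoint_left]
        intro r hr hr'
        simp only [Finset.mem_filter, Finset.mem_Ico] at hr hr'
        omega
    have h4 := Nat.mul_le_mul_left ℓ hcard
    rw [seg_add (own e a) hmt (Nat.le_add_right t 1)]
    rw [Nat.mul_add] at h4
    omega

theorem Conservative.le {ℓ M : ℕ} {e : ℕ → ℕ} {a : ℕ → Action} {m t U q : ℕ}
    (h : Conservative ℓ M e a m t U q) (hv : Valid ℓ e a m) {x : ℕ → ℕ}
    (hx : Feas M (fun _ => False) e x) :
    eta ℓ * seg ℓ M x (m + 1) t ≤ seg ℓ M (own e a) (m + 1) t + ℓ * (backlog ℓ e a m : ℝ) := by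
  classical
  have h1 : ((Finset.Ico (m + 1) U).filter (Reserved e a m)).card ≤ backlog ℓ e a m := by
    unfold backlog
    refine Finset.card_le_card fun r hr => ?_
    simp only [Finset.mem_filter, Finset.mem_Ico] at hr ⊢
    exact ⟨⟨hr.1.1, hv.reserved_lt hr.2⟩, hr.2⟩
  have h2 := h.got.trans (Nat.add_le_add_left (Nat.mul_le_mul_left ℓ h1) _)
  have h3 : (q : ℝ) ≤ seg ℓ M (own e a) (m + 1) t + ℓ * (backlog ℓ e a m : ℝ) := by
    exact_mod_cast h2
  exact (h.run.ratio x hx).trans h3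

/-! ### The value of a phase -/

/-- Needed to replace the remembered requests and actions in the switching test by the true ones. -/
theorem partialOpt_congr {ℓ : ℕ} {e e' : ℕ → ℕ} {a a' : ℕ → Action} {τ t : ℕ}
    (he : ∀ s, 1 ≤ s → s ≤ t → e s = e' s) (ha : ∀ j < τ, a j = a' j) :
    partialOpt ℓ e a τ t = partialOpt ℓ e' a' τ t := by
  have hr : ∀ (b : ℕ → Action), ∑ r ∈ Finset.Icc τ t, reward ℓ e b r
      = ∑ r ∈ Finset.Icc τ t, reward ℓ e' b r := fun b =>
    Finset.sum_congr rfl fun r hr => by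
      rw [Finset.mem_Icc] at hr
      rw [reward_eq, reward_eq, own_congr (fun s h1 h2 => he s h1 (by omega)) fun _ _ _ => rfl]
  unfold partialOpt
  congr 1
  ext v
  constructor
  · rintro ⟨b, h1, h2, rfl⟩
    exact ⟨b, fun j hj => (h1 j hj).trans (ha j hj), h2, hr b⟩
  · rintro ⟨b, h1, h2, rfl⟩
    exact ⟨b, fun j hj => (h1 j hj).trans (ha j hj).symm, h2, (hr b).symm⟩

/-- Requests of periods up to m pay only in slots before m+ℓ, so at most ℓ-1 slots of the phase
escape `seg`. -/
theorem partialOpt_le {ℓ M : ℕ} {e : ℕ → ℕ} {a : ℕ → Action} {m t : ℕ} (htM : t < M) {C : ℝ}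
    (hC : ∀ x, Feas M (fun _ => False) e x → (seg ℓ M x (m + 1) t : ℝ) + ℓ * (ℓ - 1 : ℕ) ≤ C) :
    partialOpt ℓ e a (m + 1) t ≤ C := by
  refine csSup_le ⟨_, fun j => if j < m + 1 then a j else fun _ => ⊤, fun j hj => if_pos hj,
    fun j hj => ?_, rfl⟩ ?_
  · dsimp only
    rw [if_neg (by omega)]
    exact fun i _ => Or.inl rfl
  · rintro _ ⟨b, h1, h2, rfl⟩
    refine le_trans ?_ (hC _ (feas_own M e b))
    have h3 : ∑ r ∈ Finset.Icc (m + 1) t, wt ℓ (own e b r) r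
        ≤ seg ℓ M (own e b) (m + 1) t + ℓ * (ℓ - 1) := by
      calc _ = ∑ r ∈ (Finset.range M).filter (· ∈ Finset.Icc (m + 1) t), wt ℓ (own e b r) r := by
            refine Finset.sum_congr ?_ fun _ _ => rfl
            ext r
            simp only [Finset.mem_filter, Finset.mem_range, Finset.mem_Icc]
            omega
        _ = ∑ r ∈ Finset.range M, if r ∈ Finset.Icc (m + 1) t then wt ℓ (own e b r) r else 0 :=
            Finset.sum_filter _ _
        _ ≤ seg ℓ M (own e b) (m + 1) t + ℓ * (Finset.Ico (m + 1) (m + ℓ)).card := by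
            refine sum_le_sum_add_card _ (fun r hr => ?_) fun r _ => ?_
            · rw [Finset.mem_Ico] at hr
              have := own_le e b r
              simp only [Finset.mem_Icc, wt]
              split_ifs <;> omega
            · have := wt_le (ℓ := ℓ) (own_le e b r)
              split_ifs <;> omega
        _ ≤ _ := by
            rw [Nat.card_Ico]
            exact Nat.add_le_add_left (Nat.mul_le_mul_left _ (by omega)) _
    simp only [reward_eq]
    exact_mod_cast h3

/-- Imitating `b` after period m is an admissible continuation, and the slots counted on the left
still pay the same. -/
theorem le_partialOpt {ℓ : ℕ} {e : ℕ → ℕ} {a b : ℕ → Action} {m t : ℕ}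
    (hb : ∀ t, 1 ≤ t → IsAction ℓ t (b t)) :
    ((∑ r ∈ Finset.Icc (m + 1) t,
      if m < own e b r ∧ ¬ Reserved e a m r then wt ℓ (own e b r) r else 0 : ℕ) : ℝ)
      ≤ partialOpt ℓ e a (m + 1) t := by
  have hbdd : BddAbove {v | ∃ a' : ℕ → Action, (∀ j < m + 1, a' j = a j) ∧
      (∀ j, m + 1 ≤ j → IsAction ℓ j (a' j)) ∧
      v = ∑ r ∈ Finset.Icc (m + 1) t, reward ℓ e a' r} := by
    refine ⟨∑ r ∈ Finset.Icc (m + 1) t, (ℓ : ℝ), ?_⟩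
    rintro _ ⟨b, h1, h2, rfl⟩
    refine Finset.sum_le_sum fun r _ => ?_
    rw [reward_eq]
    exact_mod_cast wt_le (own_le e b r)
  refine le_trans ?_ (le_csSup hbdd ⟨fun j => if j < m + 1 then a j else b j, fun j hj => if_pos hj,
    fun j hj => ?_, rfl⟩)
  · push_cast
    refine Finset.sum_le_sum fun r _ => ?_
    split_ifs with h
    · rw [reward_eq]
      set b' : ℕ → Action := fun j => if j < m + 1 then a j else b j with hb'
      have h1 : 1 ≤ own e b r := by omega
      obtain ⟨h2, h3, h4⟩ := (own_eq_iff h1).1 rfl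
      have : own e b' r = own e b r := by
        refine (own_eq_iff h1).2 ⟨h2, (quotes_congr rfl ?_).1 h3, fun j hj hjs hq => ?_⟩
        · simp only [hb']
          rw [if_neg (by omega)]
        · by_cases hjm : j < m + 1
          · refine h.2 (reserved_iff.2 ⟨j, hj, by omega, (quotes_congr rfl ?_).1 hq⟩)
            simp only [hb']
            rw [if_pos hjm]
          · refine h4 j hj hjs ((quotes_congr rfl ?_).1 hq)
            simp only [hb']
            rw [if_neg hjm]
      rw [this]
    · rw [reward_eq]
      positivity
  · dsimp only
    rw [if_neg (by omega)]
    exact hb j (by omega)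

/-- The omitted slots are the at most ℓ-1 reserved ones after m and the ℓ slots after t. The case t'
= t+1 covers the period of the switch, when the test is known to have failed only up to t. -/
theorem seg_le_free {ℓ M : ℕ} {e : ℕ → ℕ} {a : ℕ → Action} {x : ℕ → ℕ} (hx : ∀ r, x r ≤ r)
    {m t t' : ℕ} (hv : Valid ℓ e a m) (ht : t' ≤ t + 1) :
    seg ℓ M x (m + 1) t' ≤ (∑ r ∈ Finset.Icc (m + 1) t,
      if m < x r ∧ ¬ Reserved e a m r then wt ℓ (x r) r else 0) + ℓ * (ℓ - 1 + ℓ) := by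
  have h1 : seg ℓ M x (m + 1) t' ≤ (∑ r ∈ Finset.range M, if r ∈ Finset.Icc (m + 1) t then
      (if m < x r ∧ ¬ Reserved e a m r then wt ℓ (x r) r else 0) else 0)
      + ℓ * (Finset.Ico (m + 1) (m + ℓ) ∪ Finset.Ico (t + 1) (t + 1 + ℓ)).card := by
    refine sum_le_sum_add_card _ (fun r hr => ?_) fun r _ => ?_
    · have := hx r
      rw [Finset.mem_union, Finset.mem_Ico, Finset.mem_Ico] at hr
      by_cases hres : Reserved e a m r
      · have := hv.reserved_lt hres
        rw [if_neg (by omega)]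
        exact Nat.zero_le _
      · simp only [hres, not_false_eq_true, and_true, Finset.mem_Icc, wt]
        split_ifs <;> omega
    · have := wt_le (ℓ := ℓ) (hx r)
      split_ifs <;> omega
  refine h1.trans (add_le_add ?_ (Nat.mul_le_mul_left ℓ ?_))
  · rw [← Finset.sum_filter]
    exact Finset.sum_le_sum_of_subset fun r hr => (Finset.mem_filter.1 hr).2
  · refine (Finset.card_union_le _ _).trans ?_
    rw [Nat.card_Ico, Nat.card_Ico]
    omega

/-! ### Runs of AdaSwitch-OLTQ -/

section Step

variable (ℓ : ℕ) (ε : ℝ) (sel : ℕ → ℕ → Finset ℕ → ℕ) (estar : ℕ → ℕ) (σ : AdaState) (x : ℕ)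

theorem adaStep_time : (adaStep ℓ ε sel estar σ x).1.time = σ.time + 1 := by
  unfold adaStep
  cases σ.mode <;> dsimp only <;> split_ifs <;> rfl

theorem adaStep_reqs :
    (adaStep ℓ ε sel estar σ x).1.reqs = Function.update σ.reqs (σ.time + 1) x := by
  unfold adaStep
  cases σ.mode <;> dsimp only <;> split_ifs <;> rfl

theorem adaStep_acts : (adaStep ℓ ε sel estar σ x).1.acts
    = Function.update σ.acts (σ.time + 1) (adaStep ℓ ε sel estar σ x).2 := by
  unfold adaStep
  cases σ.mode <;> dsimp only <;> split_ifs <;> rfl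

theorem adaStep_conservative (h : σ.mode = Mode.conservative) :
    (adaStep ℓ ε sel estar σ x).2 = qfracAction σ.U (qfracCount ℓ (σ.time + 1) σ.U x) ∧
    (adaStep ℓ ε sel estar σ x).1.U
      = max (σ.time + 2) (σ.U + qfracCount ℓ (σ.time + 1) σ.U x) ∧
    (adaStep ℓ ε sel estar σ x).1.τ = σ.τ ∧
    (((adaStep ℓ ε sel estar σ x).1.mode = Mode.predictive ∧
      (adaStep ℓ ε sel estar σ x).1.φ = 0 ∧
      10 * ((ℓ : ℝ) + 1) * ℓ / ε ≤ partialOpt ℓ (adaStep ℓ ε sel estar σ x).1.reqs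
        (adaStep ℓ ε sel estar σ x).1.acts σ.τ (σ.time + 1)) ∨
    ((adaStep ℓ ε sel estar σ x).1.mode = Mode.conservative ∧
      partialOpt ℓ (adaStep ℓ ε sel estar σ x).1.reqs
        (adaStep ℓ ε sel estar σ x).1.acts σ.τ (σ.time + 1) < 10 * ((ℓ : ℝ) + 1) * ℓ / ε)) := by
  unfold adaStep
  rw [h]
  dsimp only
  split_ifs with hs
  · exact ⟨rfl, rfl, rfl, Or.inl ⟨rfl, rfl, hs⟩⟩
  · exact ⟨rfl, rfl, rfl, Or.inr ⟨rfl, not_le.1 hs⟩⟩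

theorem adaStep_predictive (h : σ.mode = Mode.predictive) :
    (adaStep ℓ ε sel estar σ x).2 = ohrr ℓ (sel (σ.time + 1))
      (fun s => if s ≤ σ.time + 1 then (adaStep ℓ ε sel estar σ x).1.reqs s else estar s) σ.acts
      σ.time (estimateM ℓ (σ.time + 1) estar - σ.time) (σ.time + 1) ∧
    (((adaStep ℓ ε sel estar σ x).1.mode = Mode.conservative ∧
      (adaStep ℓ ε sel estar σ x).1.τ = σ.time + 2 ∧
      (adaStep ℓ ε sel estar σ x).1.U = σ.time + 2 ∧
      2 * ((ℓ : ℝ) + 1) / eta ℓ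
        ≤ σ.φ + min |(x : ℝ) - estar (σ.time + 1)| ((ℓ : ℝ) + 1)) ∨
    ((adaStep ℓ ε sel estar σ x).1.mode = Mode.predictive ∧
      (adaStep ℓ ε sel estar σ x).1.φ
        = σ.φ + min |(x : ℝ) - estar (σ.time + 1)| ((ℓ : ℝ) + 1) ∧
      σ.φ + min |(x : ℝ) - estar (σ.time + 1)| ((ℓ : ℝ) + 1) < 2 * ((ℓ : ℝ) + 1) / eta ℓ)) := by
  have hc : 2 * ((ℓ : ℝ) + 1) / (eta ℓ * 1) = 2 * ((ℓ : ℝ) + 1) / eta ℓ := by rw [mul_one]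
  have hc' : ((ℓ : ℝ) + 1) / 1 = ℓ + 1 := div_one _
  rw [← hc, ← hc', adaStep_reqs]
  unfold adaStep
  rw [h]
  dsimp only
  rw [hc']
  split_ifs with hs
  · exact ⟨rfl, Or.inl ⟨rfl, rfl, rfl, hs⟩⟩
  · exact ⟨rfl, Or.inr ⟨rfl, rfl, not_le.1 hs⟩⟩

end Step

/-- The prediction error of one period. -/
def periodError (e estar : ℕ → ℕ) (s : ℕ) : ℕ := (e s - estar s) + (estar s - e s)

theorem abs_sub_eq_periodError (e estar : ℕ → ℕ) (s : ℕ) :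
    |(e s : ℝ) - (estar s : ℝ)| = periodError e estar s := by
  unfold periodError
  rcases le_total (e s) (estar s) with h | h
  · rw [Nat.sub_eq_zero_of_le h, zero_add, Nat.cast_sub h, abs_sub_comm, abs_of_nonneg]
    exact sub_nonneg.2 (by exact_mod_cast h)
  · rw [Nat.sub_eq_zero_of_le h, add_zero, Nat.cast_sub h, abs_of_nonneg]
    exact sub_nonneg.2 (by exact_mod_cast h)

section Run

variable {ℓ : ℕ} {ε : ℝ} {sel : ℕ → ℕ → Finset ℕ → ℕ} {e estar : ℕ → ℕ}

/-- The state of AdaSwitch-OLTQ after period `t`. -/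
noncomputable def adaState (ℓ : ℕ) (ε : ℝ) (sel : ℕ → ℕ → Finset ℕ → ℕ) (e estar : ℕ → ℕ) :
    ℕ → AdaState :=
  (adaSwitch ℓ ε sel estar).state e

/-- The action of AdaSwitch-OLTQ in period `t`. -/
noncomputable def adaAction (ℓ : ℕ) (ε : ℝ) (sel : ℕ → ℕ → Finset ℕ → ℕ) (e estar : ℕ → ℕ) :
    ℕ → Action :=
  (adaSwitch ℓ ε sel estar).action e

theorem adaState_succ (t : ℕ) : adaState ℓ ε sel e estar (t + 1)
    = (adaStep ℓ ε sel estar (adaState ℓ ε sel e estar t) (e (t + 1))).1 := rfl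

theorem adaAction_succ (t : ℕ) : adaAction ℓ ε sel e estar (t + 1)
    = (adaStep ℓ ε sel estar (adaState ℓ ε sel e estar t) (e (t + 1))).2 := rfl

theorem adaState_time (t : ℕ) : (adaState ℓ ε sel e estar t).time = t := by
  induction t with
  | zero => rfl
  | succ t ih => rw [adaState_succ, adaStep_time, ih]

theorem adaState_reqs (t : ℕ) : ∀ s, 1 ≤ s → s ≤ t → (adaState ℓ ε sel e estar t).reqs s = e s := by
  induction t with
  | zero => intro s h1 h2; omega
  | succ t ih =>
    intro s h1 h2
    rw [adaState_succ, adaStep_reqs, adaState_time]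
    by_cases hs : s = t + 1
    · rw [hs, Function.update_self]
    · rw [Function.update_of_ne hs, ih s h1 (by omega)]

theorem adaState_acts (t : ℕ) :
    ∀ s ≤ t, (adaState ℓ ε sel e estar t).acts s = adaAction ℓ ε sel e estar s := by
  induction t with
  | zero =>
    intro s hs
    obtain rfl : s = 0 := by omega
    rfl
  | succ t ih =>
    intro s hs
    rw [adaState_succ, adaStep_acts, adaState_time]
    by_cases hst : s = t + 1
    · rw [hst, Function.update_self, adaAction_succ]
    · rw [Function.update_of_ne hst, ih s (by omega)]

end Run

/-! ### The accounting of AdaSwitch-OLTQ -/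

/-- The total prediction error of the periods `1, …, t`. -/
def err (e estar : ℕ → ℕ) (t : ℕ) : ℕ := ∑ s ∈ Finset.Icc 1 t, periodError e estar s

theorem err_add (e estar : ℕ → ℕ) {p q : ℕ} (h : p ≤ q) :
    err e estar q = err e estar p + ∑ s ∈ Finset.Ioc p q, periodError e estar s := by
  have h1 : ∀ n, Finset.Icc 1 n = Finset.Ioc 0 n := fun n => by
    ext; simp [Nat.succ_le_iff]
  rw [err, err, h1, h1, Finset.sum_Ioc_consecutive _ (Nat.zero_le p) h]

/-- What is known when a conservative phase starts after period `m`. -/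
structure ConservativeStart (ℓ : ℕ) (ε : ℝ) (M : ℕ) (e estar : ℕ → ℕ) (a : ℕ → Action) (x : ℕ → ℕ)
    (m : ℕ) : Prop where
  robust : (eta ℓ - ε) * seg ℓ M x 1 m + ℓ * backlog ℓ e a m ≤ seg ℓ M (own e a) 1 m
  consistent : ∃ K : ℕ, (seg ℓ M x 1 m : ℝ) ≤ seg ℓ M (own e a) 1 m
    + K * (10 * ((ℓ : ℝ) + 1) * ℓ / ε + 4 * ℓ ^ 2 - 3 * ℓ) + ℓ * err e estar m ∧
    2 * ((ℓ : ℝ) + 1) * K ≤ eta ℓ * err e estar m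

/-- What is known when a predictive phase starts after period `m`. -/
structure PredictiveStart (ℓ : ℕ) (ε : ℝ) (M : ℕ) (e estar : ℕ → ℕ) (a : ℕ → Action) (x : ℕ → ℕ)
    (m : ℕ) : Prop where
  robust : (eta ℓ - ε) * seg ℓ M x 1 m + (10 * ((ℓ : ℝ) + 1) * ℓ - ℓ * (ℓ - 1))
    ≤ seg ℓ M (own e a) 1 m
  consistent : ∃ K : ℕ, (seg ℓ M x 1 m : ℝ) ≤ seg ℓ M (own e a) 1 m
    + K * (10 * ((ℓ : ℝ) + 1) * ℓ / ε + 4 * ℓ ^ 2 - 3 * ℓ)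
    + (10 * ((ℓ : ℝ) + 1) * ℓ / ε + 2 * ℓ ^ 2 - ℓ) + ℓ * err e estar m ∧
    2 * ((ℓ : ℝ) + 1) * K ≤ eta ℓ * err e estar m

variable {ℓ M : ℕ} {ε : ℝ} {e estar : ℕ → ℕ} {a : ℕ → Action} {x : ℕ → ℕ}

theorem Valid.mono {t t' : ℕ} (h : Valid ℓ e a t') (htt : t ≤ t') : Valid ℓ e a t :=
  fun j h1 h2 => h j h1 (h2.trans htt)

theorem cast_seg_add (ℓ M : ℕ) (x : ℕ → ℕ) {p q : ℕ} (hpq : p ≤ q) :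
    (seg ℓ M x 1 q : ℝ) = seg ℓ M x 1 p + seg ℓ M x (p + 1) q := by
  exact_mod_cast seg_add x (show 1 ≤ p + 1 by omega) hpq

theorem ConservativeStart.finish_robust (hε : 0 < ε) {m t : ℕ} (hmt : m ≤ t)
    (h : ConservativeStart ℓ ε M e estar a x m)
    (hle : eta ℓ * seg ℓ M x (m + 1) t ≤ seg ℓ M (own e a) (m + 1) t + ℓ * (backlog ℓ e a m : ℝ)) :
    (eta ℓ - ε) * seg ℓ M x 1 t ≤ seg ℓ M (own e a) 1 t := by
  have h1 := h.robust
  rw [cast_seg_add ℓ M x hmt, cast_seg_add ℓ M (own e a) hmt]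
  have : 0 ≤ ε * seg ℓ M x (m + 1) t := by positivity
  linarith

/-- The algorithm's reward in the unfinished phase is simply dropped: the competitor's own reward
there is at most the switching threshold plus 2ℓ²-ℓ for the slots omitted in `seg_le_free`. -/
theorem ConservativeStart.finish_consistent (hℓ : 1 ≤ ℓ) {m t t' : ℕ} (hmt : m ≤ t')
    (h : ConservativeStart ℓ ε M e estar a x m) (hv : Valid ℓ e a m)
    (hx : Feas M (fun _ => False) e x) (ht : t' ≤ t + 1)
    (hlow : ((∑ r ∈ Finset.Icc (m + 1) t,
      if m < x r ∧ ¬ Reserved e a m r then wt ℓ (x r) r else 0 : ℕ) : ℝ)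
      ≤ 10 * ((ℓ : ℝ) + 1) * ℓ / ε) :
    ∃ K : ℕ, (seg ℓ M x 1 t' : ℝ) ≤ seg ℓ M (own e a) 1 t'
    + K * (10 * ((ℓ : ℝ) + 1) * ℓ / ε + 4 * ℓ ^ 2 - 3 * ℓ)
    + (10 * ((ℓ : ℝ) + 1) * ℓ / ε + 2 * ℓ ^ 2 - ℓ) + ℓ * err e estar t' ∧
    2 * ((ℓ : ℝ) + 1) * K ≤ eta ℓ * err e estar t' := by
  obtain ⟨K, h1, h2⟩ := h.consistent
  have h3 : (err e estar m : ℝ) ≤ err e estar t' := by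
    rw [err_add e estar hmt]
    exact_mod_cast Nat.le_add_right _ _
  have h4 : (seg ℓ M x (m + 1) t' : ℝ) ≤ ((∑ r ∈ Finset.Icc (m + 1) t,
      if m < x r ∧ ¬ Reserved e a m r then wt ℓ (x r) r else 0 : ℕ) : ℝ)
      + ((ℓ * (ℓ - 1 + ℓ) : ℕ) : ℝ) := by
    exact_mod_cast seg_le_free hx.le hv ht
  have h5 : ((ℓ * (ℓ - 1 + ℓ) : ℕ) : ℝ) = 2 * (ℓ : ℝ) ^ 2 - ℓ := by
    rw [Nat.cast_mul, Nat.cast_add, Nat.cast_sub hℓ]; push_cast; ring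
  have h6 : (0 : ℝ) ≤ seg ℓ M (own e a) (m + 1) t' := Nat.cast_nonneg _
  have h7 := (eta_bounds hℓ).1
  refine ⟨K, ?_, h2.trans ?_⟩
  · rw [cast_seg_add ℓ M x hmt, cast_seg_add ℓ M (own e a) hmt]
    have : (ℓ : ℝ) * err e estar m ≤ ℓ * err e estar t' := by gcongr
    linarith
  · gcongr

/-- Consistency uses that the test still failed at t, robustness that it succeeds at t+1. -/
theorem ConservativeStart.switch (hℓ : 1 ≤ ℓ) (hε : 0 < ε) (hεη : ε < eta ℓ) {m t U q : ℕ}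
    (hmt : m ≤ t) (htM : t + 1 < M)
    (h : ConservativeStart ℓ ε M e estar a x m) (hv : Valid ℓ e a m)
    (hx : Feas M (fun _ => False) e x)
    (hlow : ((∑ r ∈ Finset.Icc (m + 1) t,
      if m < x r ∧ ¬ Reserved e a m r then wt ℓ (x r) r else 0 : ℕ) : ℝ)
      ≤ 10 * ((ℓ : ℝ) + 1) * ℓ / ε)
    (hrun : Conservative ℓ M e a m (t + 1) U q)
    (hopt : 10 * ((ℓ : ℝ) + 1) * ℓ / ε ≤ partialOpt ℓ e a (m + 1) (t + 1)) :
    PredictiveStart ℓ ε M e estar a x (t + 1) where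
  robust := by
    obtain ⟨h1, h2⟩ := eta_bounds hℓ
    have hℓ' : (1 : ℝ) ≤ ℓ := by exact_mod_cast hℓ
    have hη : 0 < eta ℓ := by linarith
    -- The bound w holds for all matchings at once, hence exceeds the phase optimum up to ℓ(ℓ-1),
    -- even if `x` itself earns little. The saving is ηw - (η-ε)w = εw.
    obtain ⟨w, hw⟩ : ∃ w : ℝ, eta ℓ * w
        = seg ℓ M (own e a) (m + 1) (t + 1) + ℓ * (backlog ℓ e a m : ℝ) :=
      ⟨_ / eta ℓ, mul_div_cancel₀ _ hη.ne'⟩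
    have hle : ∀ y, Feas M (fun _ => False) e y → (seg ℓ M y (m + 1) (t + 1) : ℝ) ≤ w :=
      fun y hy => by
        have := hrun.le hv hy
        rw [← hw] at this
        exact le_of_mul_le_mul_left this hη
    have h3 : 10 * ((ℓ : ℝ) + 1) * ℓ / ε ≤ w + ℓ * (ℓ - 1) := by
      refine hopt.trans (partialOpt_le htM fun y hy => ?_)
      have := hle y hy
      rw [Nat.cast_sub hℓ, Nat.cast_one]
      linarith
    rw [div_le_iff₀ hε] at h3
    have h4 := hle x hx
    have h5 := h.robust
    rw [cast_seg_add ℓ M x (show m ≤ t + 1 by omega),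
      cast_seg_add ℓ M (own e a) (show m ≤ t + 1 by omega)]
    have h6 : (eta ℓ - ε) * seg ℓ M x (m + 1) (t + 1) ≤ (eta ℓ - ε) * w :=
      mul_le_mul_of_nonneg_left h4 (by linarith)
    have h7 : ε * (ℓ * ((ℓ : ℝ) - 1)) ≤ 1 * (ℓ * ((ℓ : ℝ) - 1)) :=
      mul_le_mul_of_nonneg_right (by linarith) (by nlinarith)
    linarith
  consistent := h.finish_consistent hℓ (by omega) hv hx le_rfl hlow

theorem PredictiveStart.finish (hℓ : 1 ≤ ℓ) (hε : 0 < ε) (hεη : ε < eta ℓ) {p q : ℕ} (hpq : p ≤ q)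
    (h : PredictiveStart ℓ ε M e estar a x p)
    (hle : seg ℓ M x (p + 1) q ≤ seg ℓ M (own e a) (p + 1) q
      + ℓ * ∑ s ∈ Finset.Ioc p q, periodError e estar s + 2 * (ℓ * (ℓ - 1)))
    (hφ : ((∑ s ∈ Finset.Ioc p q, periodError e estar s : ℕ) : ℝ) ≤ 2 * ((ℓ : ℝ) + 1) / eta ℓ + ℓ) :
    (eta ℓ - ε) * seg ℓ M x 1 q + ℓ * backlog ℓ e a q ≤ seg ℓ M (own e a) 1 q ∧
    ∃ K : ℕ, (seg ℓ M x 1 q : ℝ) ≤ seg ℓ M (own e a) 1 q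
      + (K + 1) * (10 * ((ℓ : ℝ) + 1) * ℓ / ε + 4 * ℓ ^ 2 - 3 * ℓ) + ℓ * err e estar q ∧
      2 * ((ℓ : ℝ) + 1) * K ≤ eta ℓ * err e estar p := by
  obtain ⟨h1, h2⟩ := eta_bounds hℓ
  have hℓ' : (1 : ℝ) ≤ ℓ := by exact_mod_cast hℓ
  have hη : 0 < eta ℓ := by linarith
  have h3 : (seg ℓ M x (p + 1) q : ℝ) ≤ seg ℓ M (own e a) (p + 1) q
      + ℓ * ((∑ s ∈ Finset.Ioc p q, periodError e estar s : ℕ) : ℝ) + 2 * (ℓ * (ℓ - 1)) := by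
    have : (seg ℓ M x (p + 1) q : ℝ) ≤ seg ℓ M (own e a) (p + 1) q
      + ℓ * ((∑ s ∈ Finset.Ioc p q, periodError e estar s : ℕ) : ℝ) + 2 * (ℓ * (ℓ - 1 : ℕ)) := by
      exact_mod_cast hle
    rwa [Nat.cast_sub hℓ, Nat.cast_one] at this
  have h4 : (err e estar q : ℝ) = err e estar p
      + ((∑ s ∈ Finset.Ioc p q, periodError e estar s : ℕ) : ℝ) := by
    exact_mod_cast err_add e estar hpq
  set D : ℝ := ((∑ s ∈ Finset.Ioc p q, periodError e estar s : ℕ) : ℝ) with hD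
  rw [cast_seg_add ℓ M x hpq, cast_seg_add ℓ M (own e a) hpq, h4]
  constructor
  · have h5 := h.robust
    have h6 : (eta ℓ - ε) * seg ℓ M x (p + 1) q ≤ 1 * seg ℓ M x (p + 1) q :=
      mul_le_mul_of_nonneg_right (by linarith) (Nat.cast_nonneg _)
    have h7 : (backlog ℓ e a q : ℝ) ≤ ℓ - 1 := by
      have : (backlog ℓ e a q : ℝ) ≤ (ℓ - 1 : ℕ) := by exact_mod_cast backlog_le ℓ e a q
      rwa [Nat.cast_sub hℓ, Nat.cast_one] at this
    have h8 : (ℓ : ℝ) * backlog ℓ e a q ≤ ℓ * (ℓ - 1) := by gcongr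
    -- Error, the two boundary blocks and the final backlog cost at most ℓ(9(ℓ+1)/2 + ℓ + 3(ℓ-1)),
    -- which is less than the available credit ℓ(9ℓ+11).
    have h9 : D ≤ 9 / 2 * ((ℓ : ℝ) + 1) + ℓ := by
      refine hφ.trans (add_le_add_left ?_ _)
      rw [div_le_iff₀ hη]
      nlinarith
    have h10 : (ℓ : ℝ) * D ≤ ℓ * (9 / 2 * ((ℓ : ℝ) + 1) + ℓ) := by gcongr
    nlinarith
  · obtain ⟨K, h5, h6⟩ := h.consistent
    refine ⟨K, ?_, h6⟩
    linarith

theorem PredictiveStart.switch (hℓ : 1 ≤ ℓ) (hε : 0 < ε) (hεη : ε < eta ℓ) {p q : ℕ} (hpq : p ≤ q)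
    (h : PredictiveStart ℓ ε M e estar a x p)
    (hle : seg ℓ M x (p + 1) q ≤ seg ℓ M (own e a) (p + 1) q
      + ℓ * ∑ s ∈ Finset.Ioc p q, periodError e estar s + 2 * (ℓ * (ℓ - 1)))
    (hφ : ((∑ s ∈ Finset.Ioc p q, periodError e estar s : ℕ) : ℝ) ≤ 2 * ((ℓ : ℝ) + 1) / eta ℓ + ℓ)
    (hφ' : 2 * ((ℓ : ℝ) + 1) / eta ℓ ≤ ((∑ s ∈ Finset.Ioc p q, periodError e estar s : ℕ) : ℝ)) :
    ConservativeStart ℓ ε M e estar a x q := by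
  obtain ⟨h1, K, h2, h3⟩ := h.finish hℓ hε hεη hpq hle hφ
  have hη : 0 < eta ℓ := by linarith [eta_bounds hℓ]
  -- A pair of phases is complete; its error, at least 2(ℓ+1)/η, pays for raising K.
  refine ⟨h1, K + 1, by exact_mod_cast h2, ?_⟩
  rw [div_le_iff₀ hη] at hφ'
  rw [err_add e estar hpq]
  push_cast at *
  linarith

/-- The state of AdaSwitch-OLTQ after period `t`, compared with the matching `x`. -/
def Invariant (ℓ : ℕ) (ε : ℝ) (sel : ℕ → ℕ → Finset ℕ → ℕ) (e estar : ℕ → ℕ) (M : ℕ)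
    (x : ℕ → ℕ) (t : ℕ) : Prop :=
  Valid ℓ e (adaAction ℓ ε sel e estar) t ∧
  (((adaState ℓ ε sel e estar t).mode = Mode.conservative ∧ ∃ m q, m ≤ t ∧
      (adaState ℓ ε sel e estar t).τ = m + 1 ∧
      ConservativeStart ℓ ε M e estar (adaAction ℓ ε sel e estar) x m ∧
      Conservative ℓ M e (adaAction ℓ ε sel e estar) m t (adaState ℓ ε sel e estar t).U q ∧
      ((∑ r ∈ Finset.Icc (m + 1) t, if m < x r ∧ ¬ Reserved e (adaAction ℓ ε sel e estar) m r
        then wt ℓ (x r) r else 0 : ℕ) : ℝ) ≤ 10 * ((ℓ : ℝ) + 1) * ℓ / ε) ∨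
   ((adaState ℓ ε sel e estar t).mode = Mode.predictive ∧ ∃ p, p ≤ t ∧
      PredictiveStart ℓ ε M e estar (adaAction ℓ ε sel e estar) x p ∧
      best ℓ M (Reserved e (adaAction ℓ ε sel e estar) p) (future estar p)
        ≤ seg ℓ M (own e (adaAction ℓ ε sel e estar)) (p + 1) t
          + best ℓ M (Reserved e (adaAction ℓ ε sel e estar) t) (future estar t)
          + ℓ * ∑ s ∈ Finset.Ioc p t, (estar s - e s) ∧
      (adaState ℓ ε sel e estar t).φ = ((∑ s ∈ Finset.Ioc p t, periodError e estar s : ℕ) : ℝ) ∧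
      (adaState ℓ ε sel e estar t).φ ≤ 2 * ((ℓ : ℝ) + 1) / eta ℓ))

variable {sel : ℕ → ℕ → Finset ℕ → ℕ}

theorem invariant_zero (hℓ : 1 ≤ ℓ) (hε : 0 < ε) : Invariant ℓ ε sel e estar M x 0 := by
  refine ⟨fun j h1 h2 => by omega, Or.inl ⟨rfl, 0, 0, le_rfl, rfl, ⟨?_, 0, ?_, ?_⟩,
    conservative_init hℓ e _ 0, ?_⟩⟩
  · rw [backlog_zero, seg_empty x (by omega)]
    simp
  · rw [seg_empty x (by omega)]
    simp
    positivity
  · simp [err]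
  · simp
    positivity

theorem Invariant.step (hℓ : 1 ≤ ℓ) (hε : 0 < ε) (hεη : ε < eta ℓ) {T : ℕ}
    (he : ∀ t, 1 ≤ t → e t ≤ ℓ) (hestar : ∀ t, 1 ≤ t → estar t ≤ ℓ)
    (hT : ∀ s, T < s → estar s = 0)
    (hsel : ∀ t r (S : Finset ℕ), S.Nonempty → sel t r S ∈ S)
    {b : ℕ → Action} (hb : ∀ t, 1 ≤ t → IsAction ℓ t (b t)) {t : ℕ} (htT : t + 1 ≤ T)
    (h : Invariant ℓ ε sel e estar (T + ℓ) (own e b) t) :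
    Invariant ℓ ε sel e estar (T + ℓ) (own e b) (t + 1) := by
  have hη : 0 < eta ℓ := by linarith [eta_bounds hℓ]
  have hx := feas_own (T + ℓ) e b
  obtain ⟨hv, h⟩ := h
  have htime := adaState_time (ℓ := ℓ) (ε := ε) (sel := sel) (e := e) (estar := estar) t
  have hreqs := adaState_reqs (ℓ := ℓ) (ε := ε) (sel := sel) (e := e) (estar := estar) (t + 1)
  have hacts := adaState_acts (ℓ := ℓ) (ε := ε) (sel := sel) (e := e) (estar := estar)
  have hact := adaAction_succ (ℓ := ℓ) (ε := ε) (sel := sel) (e := e) (estar := estar) t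
  have hstate := adaState_succ (ℓ := ℓ) (ε := ε) (sel := sel) (e := e) (estar := estar) t
  rcases h with ⟨hmode, m, q, hmt, hτ, hstart, hrun, hlow⟩ | ⟨hmode, p, hpt, hstart, hpot, hφ, hφ'⟩
  · obtain ⟨g1, g2, g3, g4⟩ := adaStep_conservative ℓ ε sel estar _ (e (t + 1)) hmode
    rw [← hact, htime] at g1
    rw [← hstate, htime] at g2
    rw [← hstate, hτ] at g3
    rw [← hstate, htime, hτ, partialOpt_congr hreqs fun j hj => hacts (t + 1) j (by omega)] at g4
    obtain ⟨hq, q', hrun'⟩ := hrun.step hℓ htT g1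
    rw [← g2] at hrun'
    refine ⟨hv.succ hq, ?_⟩
    rcases g4 with ⟨k1, k2, k3⟩ | ⟨k1, k2⟩
    · refine Or.inr ⟨k1, t + 1, le_rfl, hstart.switch hℓ hε hεη hmt (by omega) (hv.mono hmt) hx hlow
        hrun' k3, by simp, by rw [k2]; simp, by rw [k2]; positivity⟩
    · exact Or.inl ⟨k1, m, q', by omega, g3, hstart, hrun', (le_partialOpt hb).trans k2.le⟩
  · obtain ⟨g1, g2⟩ := adaStep_predictive ℓ ε sel estar _ (e (t + 1)) hmode
    rw [← hact, htime, ← hstate] at g1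
    -- The error of one period is at most ℓ, below the cap c = ℓ+1, so the cap never binds and φ is
    -- the exact error of the phase.
    have hd : min |(e (t + 1) : ℝ) - estar (t + 1)| ((ℓ : ℝ) + 1) = periodError e estar (t + 1) := by
      rw [abs_sub_eq_periodError, min_eq_left]
      have h1 := he (t + 1) (by omega)
      have h2 := hestar (t + 1) (by omega)
      have : periodError e estar (t + 1) ≤ ℓ + 1 := by unfold periodError; omega
      exact_mod_cast this
    have hdℓ : (periodError e estar (t + 1) : ℝ) ≤ ℓ := by
      have h1 := he (t + 1) (by omega)
      have h2 := hestar (t + 1) (by omega)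
      have : periodError e estar (t + 1) ≤ ℓ := by unfold periodError; omega
      exact_mod_cast this
    have hIoc : ∀ f : ℕ → ℕ, ∑ s ∈ Finset.Ioc p (t + 1), f s
        = ∑ s ∈ Finset.Ioc p t, f s + f (t + 1) := fun f => Finset.sum_Ioc_succ_top hpt f
    have hsum : (adaState ℓ ε sel e estar t).φ + periodError e estar (t + 1)
        = ((∑ s ∈ Finset.Ioc p (t + 1), periodError e estar s : ℕ) : ℝ) := by
      rw [hIoc, hφ]; push_cast; rfl
    rw [← hstate, htime, hd, hsum] at g2
    obtain ⟨hq, hstep⟩ := predictive_step hℓ (e := e) (fun r S hS => hsel (t + 1) r S hS) hT htT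
      (e' := fun s => if s ≤ t + 1 then (adaState ℓ ε sel e estar (t + 1)).reqs s else estar s)
      (fun s h1 h2 => by simp only [h2, if_true]; exact hreqs s h1 h2)
      (fun s hs => by simp only [Nat.not_le.2 hs, if_false])
      (fun s _ h2 => hacts t s h2) g1
    have hpot' : best ℓ (T + ℓ) (Reserved e (adaAction ℓ ε sel e estar) p) (future estar p)
        ≤ seg ℓ (T + ℓ) (own e (adaAction ℓ ε sel e estar)) (p + 1) (t + 1)
          + best ℓ (T + ℓ) (Reserved e (adaAction ℓ ε sel e estar) (t + 1)) (future estar (t + 1))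
          + ℓ * ∑ s ∈ Finset.Ioc p (t + 1), (estar s - e s) := by
      rw [hIoc, seg_add _ (show p + 1 ≤ t + 1 by omega) (Nat.le_add_right t 1), Nat.mul_add]
      omega
    refine ⟨hv.succ hq, ?_⟩
    rcases g2 with ⟨k1, k2, k3, k4⟩ | ⟨k1, k2, k3⟩
    · refine Or.inl ⟨k1, t + 1, 0, le_rfl, k2, ?_, by rw [k3]; exact conservative_init hℓ e _ _, ?_⟩
      · refine hstart.switch hℓ hε hεη (by omega)
          (predictive_phase (by omega) (hv.mono hpt) hpot' hx) ?_ k4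
        rw [← hsum]
        linarith
      · simp
        positivity
    · exact Or.inr ⟨k1, p, by omega, hstart, hpot', k2, k2.trans_le k3.le⟩

theorem adaSwitch_bounds (hℓ : 1 ≤ ℓ) (hε : 0 < ε) (hεη : ε < eta ℓ) {T : ℕ}
    (he : ∀ t, 1 ≤ t → e t ≤ ℓ) (hestar : ∀ t, 1 ≤ t → estar t ≤ ℓ)
    (hTe : ∀ s, T < s → e s = 0) (hT : ∀ s, T < s → estar s = 0)
    (hsel : ∀ t r (S : Finset ℕ), S.Nonempty → sel t r S ∈ S)
    {b : ℕ → Action} (hb : ∀ t, 1 ≤ t → IsAction ℓ t (b t)) :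
    (eta ℓ - ε) * val ℓ e b ≤ val ℓ e (adaAction ℓ ε sel e estar) ∧
    val ℓ e b ≤ val ℓ e (adaAction ℓ ε sel e estar)
      + ℓ / ε * (24 * ℓ + 8 * eta ℓ * err e estar T) := by
  have hx := feas_own (T + ℓ) e b
  have hinv : ∀ t ≤ T, Invariant ℓ ε sel e estar (T + ℓ) (own e b) t := by
    intro t
    induction t with
    | zero => exact fun _ => invariant_zero hℓ hε
    | succ t ih => exact fun ht => (ih (by omega)).step hℓ hε hεη he hestar hT hsel hb ht
  obtain ⟨h1, h2⟩ := eta_bounds hℓ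
  have hℓ' : (1 : ℝ) ≤ ℓ := by exact_mod_cast hℓ
  have hη : 0 < eta ℓ := by linarith
  rw [val_eq hTe, val_eq hTe, mval_eq_seg fun r _ => own_le_horizon hTe b r,
    mval_eq_seg fun r _ => own_le_horizon hTe _ r]
  have key : (eta ℓ - ε) * seg ℓ (T + ℓ) (own e b) 1 T
        ≤ seg ℓ (T + ℓ) (own e (adaAction ℓ ε sel e estar)) 1 T ∧
      ∃ K : ℕ, (seg ℓ (T + ℓ) (own e b) 1 T : ℝ)
        ≤ seg ℓ (T + ℓ) (own e (adaAction ℓ ε sel e estar)) 1 T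
          + (K + 1) * (10 * ((ℓ : ℝ) + 1) * ℓ / ε + 4 * ℓ ^ 2 - 3 * ℓ) + ℓ * err e estar T ∧
        2 * ((ℓ : ℝ) + 1) * K ≤ eta ℓ * err e estar T := by
    obtain ⟨hv, ⟨-, m, q, hmT, -, hstart, hrun, hlow⟩ | ⟨-, p, hpT, hstart, hpot, hφ, hφ'⟩⟩ :=
      hinv T le_rfl
    · refine ⟨hstart.finish_robust hε hmT (hrun.le (hv.mono hmT) hx), ?_⟩
      obtain ⟨K, g1, g2⟩ :=
        hstart.finish_consistent hℓ hmT (hv.mono hmT) hx (Nat.le_add_right T 1) hlow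
      refine ⟨K, g1.trans ?_, g2⟩
      nlinarith
    · rw [hφ] at hφ'
      obtain ⟨g1, K, g2, g3⟩ := hstart.finish hℓ hε hεη hpT
        (predictive_phase hpT (hv.mono hpT) hpot hx) (by linarith)
      refine ⟨le_trans ?_ g1, K, g2, g3.trans ?_⟩
      · have : (0 : ℝ) ≤ ℓ * backlog ℓ e (adaAction ℓ ε sel e estar) T := by positivity
        linarith
      · rw [err_add e estar hpT]
        gcongr
        exact Nat.le_add_right _ _
  refine ⟨key.1, ?_⟩
  obtain ⟨K, g1, g2⟩ := key.2
  refine g1.trans ?_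
  rw [add_assoc]
  refine add_le_add_right ?_ _
  set E : ℝ := (err e estar T : ℝ) with hE
  have hE0 : 0 ≤ E := Nat.cast_nonneg _
  have hK0 : (0 : ℝ) ≤ K := Nat.cast_nonneg _
  -- With ε < η ≤ 1 the bracket is at most (K+1)(14ℓ+7) + ηE. Here 14(ℓ+1)K ≤ 7ηE and 14ℓ+7 ≤ 24ℓ,
  -- which yields the constants 24 and 8.
  have g3 : (K + 1) * (10 * ((ℓ : ℝ) + 1) * ℓ / ε + 4 * ℓ ^ 2 - 3 * ℓ) + ℓ * E
      = ℓ / ε * ((K + 1) * (10 * (ℓ + 1) + ε * (4 * ℓ - 3)) + ε * E) := by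
    field_simp
    ring
  rw [g3]
  refine mul_le_mul_of_nonneg_left ?_ (by positivity)
  have g4 : ε * (4 * (ℓ : ℝ) - 3) ≤ 1 * (4 * ℓ - 3) :=
    mul_le_mul_of_nonneg_right (by linarith) (by linarith)
  have g5 : ε * E ≤ eta ℓ * E := by gcongr
  have g6 : ((K : ℝ) + 1) * (10 * (ℓ + 1) + ε * (4 * ℓ - 3)) ≤ (K + 1) * (14 * (ℓ + 1) - 7) := by
    refine mul_le_mul_of_nonneg_left ?_ (by positivity)
    linarith
  nlinarith

/-- Quoting the current period to the first request of each period earns ℓ in period t. Boundedness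
is needed because the `sSup` of an unbounded set of reals is 0. -/
theorem opt_pos (hℓ : 1 ≤ ℓ) {T t : ℕ} (hTe : ∀ s, T < s → e s = 0) (ht : 1 ≤ t) (het : e t ≠ 0)
    (hbdd : BddAbove {v | ∃ a : ℕ → Action, (∀ t, 1 ≤ t → IsAction ℓ t (a t)) ∧ v = val ℓ e a}) :
    0 < opt ℓ e := by
  set b : ℕ → Action := fun s i => if i = 1 then (s : ℕ∞) else ⊤ with hb
  have hbv : ∀ t, 1 ≤ t → IsAction ℓ t (b t) := by
    intro s _ i _
    by_cases hi : i = 1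
    · exact Or.inr ⟨0, hℓ, by simp [hb, hi]⟩
    · exact Or.inl (by simp [hb, hi])
  refine lt_of_lt_of_le ?_ (le_csSup hbdd ⟨b, hbv, rfl⟩)
  have hq : ∀ s, Quotes e b s t → s = t := by
    rintro s ⟨i, -, hi⟩
    simp only [hb] at hi
    split_ifs at hi with h
    · exact_mod_cast hi
    · exact absurd hi (ENat.top_ne_natCast t)
  have hown : own e b t = t := by
    refine (own_eq_iff ht).2 ⟨le_rfl, ⟨1, Finset.mem_Icc.2 ⟨le_rfl, by omega⟩, by simp [hb]⟩,
      fun j _ hjt hj => ?_⟩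
    have := hq j hj
    omega
  rw [val_eq hTe, Nat.cast_pos]
  have htT : t ≤ T := by
    by_contra! h
    exact het (hTe t h)
  refine lt_of_lt_of_le ?_ (Finset.single_le_sum (f := fun r => wt ℓ (own e b r) r)
    (fun _ _ => Nat.zero_le _) (Finset.mem_range.2 (show t < T + ℓ by omega)))
  rw [hown, wt_of_ne (by omega)]
  omega

theorem exists_horizon {f : ℕ → ℕ} (h : Summable fun t : ℕ => (f (t + 1) : ℝ)) :
    ∃ T, ∀ s, T < s → f s = 0 := by
  obtain ⟨T, hT⟩ := Filter.eventually_atTop.1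
    (h.tendsto_atTop_zero.eventually (gt_mem_nhds one_pos))
  refine ⟨T, fun s hs => ?_⟩
  have := hT (s - 1) (by omega)
  rw [Nat.sub_add_cancel (by omega)] at this
  have : f s < 1 := by exact_mod_cast this
  omega

theorem tsum_abs_sub_eq {T : ℕ} (hTe : ∀ s, T < s → e s = 0) (hT : ∀ s, T < s → estar s = 0) :
    ∑' t : ℕ, |(e (t + 1) : ℝ) - (estar (t + 1) : ℝ)| = err e estar T := by
  simp only [abs_sub_eq_periodError]
  rw [tsum_eq_sum (s := Finset.range T) fun t ht => by
    rw [Finset.mem_range] at ht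
    rw [periodError, hTe _ (by omega), hT _ (by omega)]
    simp]
  rw [err, Nat.cast_sum, Finset.range_eq_Ico, Finset.sum_Ico_add' (fun s => (periodError e estar s : ℝ)) 0 T 1]
  rfl

end OLTQ

theorem mainTheorem5 (ℓ : ℕ) (hℓ : 1 ≤ ℓ) (e estar : ℕ → ℕ)
    (he : ∀ t, 1 ≤ t → e t ≤ ℓ) (hestar : ∀ t, 1 ≤ t → estar t ≤ ℓ)
    (hsum : Summable fun t : ℕ => (e (t + 1) : ℝ))
    (hsumstar : Summable fun t : ℕ => (estar (t + 1) : ℝ))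
    (hne : ∃ t, 1 ≤ t ∧ e t ≠ 0)
    (ε : ℝ) (hε : 0 < ε) (hεη : ε < OLTQ.eta ℓ)
    (sel : ℕ → ℕ → Finset ℕ → ℕ)
    (hsel : ∀ t r (S : Finset ℕ), S.Nonempty → sel t r S ∈ S) :
    max (OLTQ.eta ℓ - ε)
        (1 - ℓ / (ε * OLTQ.opt ℓ e) *
          (24 * ℓ + 8 * OLTQ.eta ℓ * ∑' t : ℕ, |(e (t + 1) : ℝ) - (estar (t + 1) : ℝ)|))
      ≤ OLTQ.comp ℓ e (OLTQ.adaSwitch ℓ ε sel estar) := by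
  open OLTQ in
  obtain ⟨T1, hT1⟩ := exists_horizon hsum
  obtain ⟨T2, hT2⟩ := exists_horizon hsumstar
  have hTe : ∀ s, max T1 T2 < s → e s = 0 := fun s hs => hT1 s (by omega)
  have hTs : ∀ s, max T1 T2 < s → estar s = 0 := fun s hs => hT2 s (by omega)
  have hmain := fun (b : ℕ → Action) (hb : ∀ t, 1 ≤ t → IsAction ℓ t (b t)) =>
    adaSwitch_bounds (sel := sel) hℓ hε hεη he hestar hTe hTs hsel hb
  rw [tsum_abs_sub_eq hTe hTs]
  have hcomp : comp ℓ e (adaSwitch ℓ ε sel estar)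
      = val ℓ e (adaAction ℓ ε sel e estar) / opt ℓ e := rfl
  set v := val ℓ e (adaAction ℓ ε sel e estar) with hv
  set L : ℝ := 24 * ℓ + 8 * eta ℓ * err e estar (max T1 T2) with hL
  obtain ⟨t, ht, het⟩ := hne
  have hpos : 0 < opt ℓ e := opt_pos hℓ hTe ht het ⟨v + ℓ / ε * L, by
    rintro _ ⟨b, hb, rfl⟩
    exact (hmain b hb).2⟩
  have hne' : {v | ∃ a : ℕ → Action, (∀ t, 1 ≤ t → IsAction ℓ t (a t)) ∧ v = val ℓ e a}.Nonempty :=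
    ⟨_, fun _ _ => ⊤, fun _ _ _ _ => Or.inl rfl, rfl⟩
  have h1 : opt ℓ e ≤ v / (eta ℓ - ε) := csSup_le hne' (by
    rintro _ ⟨b, hb, rfl⟩
    rw [le_div_iff₀ (by linarith), mul_comm]
    exact (hmain b hb).1)
  have h2 : opt ℓ e ≤ v + ℓ / ε * L := csSup_le hne' (by
    rintro _ ⟨b, hb, rfl⟩
    exact (hmain b hb).2)
  rw [hcomp]
  refine max_le ?_ ?_
  · rw [le_div_iff₀ hpos]
    rw [le_div_iff₀ (by linarith)] at h1
    linarith
  · rw [le_div_iff₀ hpos]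
    have : (1 - ℓ / (ε * opt ℓ e) * L) * opt ℓ e = opt ℓ e - ℓ / ε * L := by
      field_simp
    linarith
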